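/- Let $d$ be the dimension, let $\mathbb{T}^d=(\mathbb{R}/2\pi\mathbb{Z})^d$ with Lebesgue measure $dx$, and let $(X_t)_{t\ge 0}$ be a stochastic process on $\mathbb{T}^d$ for which there are probability distributions $(D_t)_{t\ge0}$ on $\mathbb{T}^d$ such that (1) $X_{t_2}-X_{t_1}\sim D_{t_2-t_1}$ for all $0\le t_1\le t_2$; (2) for all $0\le t_1\le\dots\le t_n$ the increments $X_{t_2}-X_{t_1},\dots,X_{t_n}-X_{t_{n-1}}$ are independent; (3) $D_{t+s}=D_t\star D_s$ for all $s,t\ge 0$, where $\star$ denotes convolution. Assume that for every $t>0$ $$D_t=\beta_t\,\delta+(1-\beta_t)\,\gamma_t ,$$ where $\delta$ is the Dirac mass at $0$, $\beta_t\in[0,1]$, and $\gamma_t\in L^2(\mathbb{T}^d)$ is a probability density function, and that $\beta_t$ is not identically $1$ on $(0,\infty)$. Write $\hat\gamma_t(k)=\int_{\mathbb{T}^d}\gamma_t(x)e^{-ik\cdot x}\,dx$ for $k\in\mathbb{Z}^d$, and let $$\mathcal{F}_d=\{\mathbf{1}_{\Omega} : \Omega\subseteq\mathbb{T}^d \text{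 open},\ \mathrm{Lebesgue}_d(\partial\Omega)=0\}.$$ If there is a time $t_0>0$ such that the Fourier coefficients $\{\hat\gamma_{t_0}(k)\}_{k\in\mathbb{Z}^d}$ are all distinct and nonzero, then $\mathcal{F}_d$ is reconstructible by $X_t$; that is, there is a function $A$, from real-valued functions on $[0,\infty)$ to real-valued functions on $\mathbb{T}^d$, such that for every $f\in\mathcal{F}_d$, with probability $1$ there exists a (random) shift $\theta\in\mathbb{T}^d$ such that $$A\big((f(X_t))_{t\ge0}\big)(x)=f(x+\theta)\quad\text{for almost all } x\in\mathbb{T}^d .$$ -/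

import Mathlib

open MeasureTheory ProbabilityTheory
open scoped NNReal

noncomputable section

/-- Positivity of the period `2π`, which makes the Lebesgue measure available on `ℝ/2πℤ`. -/
instance factTwoPiPos : Fact (0 < 2 * Real.pi) := ⟨Real.two_pi_pos⟩

/-- The torus `𝕋ᵈ = (ℝ/2πℤ)ᵈ`. Its `volume` is the product of the Lebesgue measures on `ℝ/2πℤ`,
of total mass `(2π)ᵈ`. -/
abbrev Torus (d : ℕ) : Type := Fin d → AddCircle (2 * Real.pi)

/-- The Fourier coefficient `ĝ(k) = ∫ g(x) e^{-i k·x} dx` over `𝕋ᵈ` with respect to Lebesgue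
measure (not normalised), for `k ∈ ℤᵈ`. On `ℝ/2πℤ`, `fourier n x = e^{i n x}`. -/
def torusFourierCoeff {d : ℕ} (g : Torus d → ℂ) (k : Fin d → ℤ) : ℂ :=
  ∫ x : Torus d, g x * ∏ j, fourier (-k j) (x j)

/-- The exponential in `torusFourierCoeff` is `e^{-i k·x}`. -/
theorem prod_fourier_neg_eq_exp {d : ℕ} (k : Fin d → ℤ) (x : Fin d → ℝ) :
    ∏ j, fourier (-k j) ((x j : ℝ) : AddCircle (2 * Real.pi))
      = Complex.exp (-Complex.I * ∑ j, (k j : ℂ) * (x j : ℂ)) := by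
  rw [Finset.mul_sum, Complex.exp_sum]
  refine Finset.prod_congr rfl fun j _ => ?_
  rw [fourier_coe_apply]
  congr 1
  have : (Real.pi : ℂ) ≠ 0 := by exact_mod_cast Real.pi_ne_zero
  push_cast
  field_simp

/-- The process `X` on `𝕋ᵈ` has independent increments, with increment laws `D t` forming a
convolution semigroup:
* `X t₂ - X t₁` has law `D (t₂ - t₁)` whenever `t₁ ≤ t₂`;
* for `t₁ ≤ ⋯ ≤ tₙ` the increments `X t₂ - X t₁, …, X tₙ - X tₙ₋₁` are independent;
* `D (s + t) = D s ⋆ D t`.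

Nothing is assumed about the law of `X 0`, nor about the regularity of the paths. -/
structure IsInfDivProcess {Ω : Type*} [MeasurableSpace Ω] {d : ℕ} (X : ℝ≥0 → Ω → Torus d)
    (P : Measure Ω) (D : ℝ≥0 → Measure (Torus d)) : Prop where
  measurable : ∀ t, Measurable (X t)
  map_sub : ∀ t₁ t₂, t₁ ≤ t₂ → P.map (fun ω => X t₂ ω - X t₁ ω) = D (t₂ - t₁)
  indep : HasIndepIncrements X P
  conv : ∀ s t, D (s + t) = Measure.conv (D s) (D t)

/-- `γ` is a square-integrable probability density function on `𝕋ᵈ`. -/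
structure IsL2Density {d : ℕ} (γ : Torus d → ℝ) : Prop where
  nonneg : 0 ≤ᵐ[volume] γ
  integral_eq_one : ∫ x, γ x = 1
  memLp : MemLp γ 2 volume

/-- For every `t > 0`, `D t = β t • δ₀ + (1 - β t) • γ t` with `β t ∈ [0, 1]`, where `δ₀` is the
unit atom at `0` and `γ t` is a probability density in `L²(𝕋ᵈ)`. -/
structure IsAtomDensityMixture {d : ℕ} (D : ℝ≥0 → Measure (Torus d)) (β : ℝ≥0 → ℝ)
    (γ : ℝ≥0 → Torus d → ℝ) : Prop where
  mem_Icc : ∀ t, 0 < t → β t ∈ Set.Icc (0 : ℝ) 1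
  density : ∀ t, 0 < t → IsL2Density (γ t)
  eq_mixture : ∀ t, 0 < t → D t = ENNReal.ofReal (β t) • Measure.dirac 0
    + ENNReal.ofReal (1 - β t) • volume.withDensity (fun x => ENNReal.ofReal (γ t x))

/-- The family of indicators of open subsets of `𝕋ᵈ` whose boundary has Lebesgue measure `0`. -/
def openIndicators (d : ℕ) : Set (Torus d → ℝ) :=
  {f | ∃ U : Set (Torus d), IsOpen U ∧ volume (frontier U) = 0 ∧ f = U.indicator (fun _ => 1)}

/-- A family `F` of functions on `𝕋ᵈ` is reconstructible by `X` if there is one map `A` from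
traces to functions on `𝕋ᵈ` such that, for every `f ∈ F`, almost surely, `A` applied to the trace
`t ↦ f (X t)` is, up to a (random) translation, almost everywhere equal to `f`. -/
def Reconstructible {Ω : Type*} [MeasurableSpace Ω] {d : ℕ} (F : Set (Torus d → ℝ))
    (X : ℝ≥0 → Ω → Torus d) (P : Measure Ω) : Prop :=
  ∃ A : (ℝ≥0 → ℝ) → (Torus d → ℝ), ∀ f ∈ F, ∀ᵐ ω ∂P, ∃ θ : Torus d,
    ∀ᵐ x ∂(volume : Measure (Torus d)), A (fun t => f (X t ω)) x = f (x + θ)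

end

open MeasureTheory ProbabilityTheory
open scoped NNReal

set_option linter.unusedSectionVars false

noncomputable section

namespace SceneryReconstruction

open UnitAddTorus Filter Topology ComplexConjugate

/-! Only the times `n • t₀` are used. Along them, after rescaling to `(ℝ/ℤ)^d`, the process is a
walk with i.i.d. steps whose law has characteristic coefficients `φ(k) = β + (1 - β) γ̂(-k)`, where
`β = β t₀` and `γ̂` is taken at time `t₀`. The convolution semigroup and the Riemann–Lebesgue lemma
force `β ≠ 1` when `d > 0` (`atom_ne_one`). Hence the `φ(k)` are pairwise distinct, converge to `β`
at infinity and never equal `β`.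

Observable statistics. Since `φ(k) ≠ 1` for `k ≠ 0`, a law of large numbers for orthogonal variables
gives the time averages of all characters of finitely many positions. Weyl's criterion and the
portmanteau theorem extend this to indicators of sets with null boundary
(`tendsto_average_prod_indicator`). The trace therefore determines, almost surely and for every
starting point, the correlations of `f` along the walk started from the uniform law.

From correlations to Fourier coefficients. As a function of one lag `n`, a correlation is an
exponential sum `∑ b_q φ(q)^n`. Its nodes are distinct and accumulate only at the non-node `β`, so
it determines each `b_q` (`eq_of_tsum_mul_pow_eq`). Treating the lags one by one yields every
product `f̂(p₁)⋯f̂(pₘ)` with `p₁ + ⋯ + pₘ = 0` (`prod_coeff_eq`).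

From products to `f`. If two real functions share these products, the ratio of their coefficients is
multiplicative where defined, so it extends to a character of `ℤ^d`, which is a translation
(`exists_eq_mul_mFourier`). The map `A` may thus return the indicator of any measurable set whose
correlations match the observed averages. -/

/-! ### Fourier analysis on `(ℝ/ℤ)^ι` -/

/-- The probability Haar measure on `(ℝ/ℤ)^ι`. -/
abbrev haarTorus (ι : Type*) [Fintype ι] : Measure (UnitAddTorus ι) :=
  Measure.pi fun _ => AddCircle.haarAddCircle

variable {ι : Type*} [Fintype ι]

theorem mFourier_apply_add (k : ι → ℤ) (x y : UnitAddTorus ι) :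
    mFourier k (x + y) = mFourier k x * mFourier k y := by
  simp only [mFourier, ContinuousMap.coe_mk, ← Finset.prod_mul_distrib]
  refine Finset.prod_congr rfl fun i _ => ?_
  simp [fourier_apply, AddCircle.toCircle_add]

theorem mFourier_apply_zero (k : ι → ℤ) : mFourier k (0 : UnitAddTorus ι) = 1 := by
  simp [mFourier]

theorem norm_mFourier_apply (k : ι → ℤ) (x : UnitAddTorus ι) : ‖mFourier k x‖ = 1 := by
  simp only [mFourier, ContinuousMap.coe_mk, norm_prod, fourier_apply, Circle.norm_coe,
    Finset.prod_const_one]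

theorem mFourier_apply_finset_sum {κ : Type*} (s : Finset κ) (k : ι → ℤ) (x : κ → UnitAddTorus ι) :
    mFourier k (∑ i ∈ s, x i) = ∏ i ∈ s, mFourier k (x i) := by
  classical
  induction s using Finset.induction_on with
  | empty => simp [mFourier_apply_zero]
  | insert a s ha ih => rw [Finset.sum_insert ha, Finset.prod_insert ha, mFourier_apply_add, ih]

theorem mFourier_finset_sum {κ : Type*} (s : Finset κ) (k : κ → ι → ℤ) (x : UnitAddTorus ι) :
    mFourier (∑ i ∈ s, k i) x = ∏ i ∈ s, mFourier (k i) x := by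
  classical
  induction s using Finset.induction_on with
  | empty => simp [mFourier_zero]
  | insert a s ha ih => rw [Finset.sum_insert ha, Finset.prod_insert ha, mFourier_add, ih]

/-- The Fourier coefficient of a complex function on `(ℝ/ℤ)^ι`. -/
def coeff (f : UnitAddTorus ι → ℂ) (k : ι → ℤ) : ℂ := ∫ x, mFourier (-k) x * f x ∂haarTorus ι

theorem coeff_congr_ae {f g : UnitAddTorus ι → ℂ} (h : f =ᵐ[haarTorus ι] g) : coeff f = coeff g := by
  ext k
  refine integral_congr_ae ?_
  filter_upwards [h] with x hx
  rw [hx]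

theorem integral_mFourier (k : ι → ℤ) :
    ∫ x, mFourier k x ∂haarTorus ι = if k = 0 then 1 else 0 := by
  classical
  have h := orthonormal_iff_ite.1 (orthonormal_mFourier (d := ι)) 0 k
  simp only [ContinuousMap.inner_toLp, mFourier_zero] at h
  simp_rw [eq_comm (a := k)]
  convert! h using 1
  refine integral_congr_ae (.of_forall fun x => ?_)
  simp

theorem coeff_conj (f : UnitAddTorus ι → ℂ) (k : ι → ℤ) :
    conj (coeff (fun x => conj (f x)) k) = coeff f (-k) := by
  unfold coeff
  rw [← integral_conj]
  refine integral_congr_ae (.of_forall fun x => ?_)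
  simp [mFourier_neg]

theorem hasSum_conj_coeff_mul {u v : UnitAddTorus ι → ℂ} (hu : MemLp u 2 (haarTorus ι))
    (hv : MemLp v 2 (haarTorus ι)) :
    HasSum (fun k => conj (coeff u k) * coeff v k) (∫ x, conj (u x) * v x ∂haarTorus ι) := by
  have h := hasSum_prod_mFourierCoeff (d := ι) (hu.toLp u) (hv.toLp v)
  have e1 : ∀ k, mFourierCoeff (hu.toLp u) k = coeff u k := fun k =>
    congrFun (coeff_congr_ae hu.coeFn_toLp) k
  have e2 : ∀ k, mFourierCoeff (hv.toLp v) k = coeff v k := fun k =>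
    congrFun (coeff_congr_ae hv.coeFn_toLp) k
  simp only [e1, e2] at h
  convert h using 1
  refine integral_congr_ae ?_
  filter_upwards [hu.coeFn_toLp, hv.coeFn_toLp] with x h1 h2
  rw [h1, h2]

/-- Parseval's identity in bilinear form. -/
theorem hasSum_coeff_neg_mul {u v : UnitAddTorus ι → ℂ} (hu : MemLp u 2 (haarTorus ι))
    (hv : MemLp v 2 (haarTorus ι)) :
    HasSum (fun k => coeff u (-k) * coeff v k) (∫ x, u x * v x ∂haarTorus ι) := by
  have := hasSum_conj_coeff_mul (u := fun x => conj (u x)) hu.star hv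
  simpa [coeff_conj] using this

theorem ae_eq_zero_of_coeff_eq_zero {u : UnitAddTorus ι → ℂ} (hu : MemLp u 2 (haarTorus ι))
    (h : ∀ k, coeff u k = 0) : u =ᵐ[haarTorus ι] 0 := by
  have h1 := (hasSum_conj_coeff_mul hu hu).tsum_eq
  simp only [h, mul_zero, tsum_zero] at h1
  have h2 : ∫ x, ‖u x‖ ^ 2 ∂haarTorus ι = 0 := by
    have : ∫ x, ((‖u x‖ ^ 2 : ℝ) : ℂ) ∂haarTorus ι = 0 := by
      rw [h1]
      refine integral_congr_ae (.of_forall fun x => ?_)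
      simp [Complex.conj_mul']
    rw [integral_complex_ofReal] at this
    exact_mod_cast this
  rw [integral_eq_zero_iff_of_nonneg (fun x => sq_nonneg _)
    ((memLp_two_iff_integrable_sq_norm hu.1).1 hu)] at h2
  filter_upwards [h2] with x hx
  simpa using hx

theorem ae_eq_of_coeff_eq {u v : UnitAddTorus ι → ℂ} (hu : MemLp u 2 (haarTorus ι))
    (hv : MemLp v 2 (haarTorus ι)) (h : ∀ k, coeff u k = coeff v k) : u =ᵐ[haarTorus ι] v := by
  have hi : ∀ {w : UnitAddTorus ι → ℂ}, MemLp w 2 (haarTorus ι) → ∀ k,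
      Integrable (fun x => mFourier (-k) x * w x) (haarTorus ι) := fun hw k =>
    (hw.integrable (by norm_num)).bdd_mul (c := 1)
      (map_continuous (mFourier (-k))).aestronglyMeasurable (.of_forall fun x => (norm_mFourier_apply _ _).le)
  have := ae_eq_zero_of_coeff_eq_zero (hu.sub hv) fun k => by
    simp only [coeff, Pi.sub_apply, mul_sub]
    rw [integral_sub (hi hu k) (hi hv k)]
    exact sub_eq_zero.2 (h k)
  filter_upwards [this] with x hx
  simpa [sub_eq_zero] using hx

theorem tendsto_coeff_cofinite {u : UnitAddTorus ι → ℂ} (hu : MemLp u 2 (haarTorus ι)) :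
    Tendsto (coeff u) cofinite (𝓝 0) := by
  have h := (hasSum_conj_coeff_mul hu hu).summable.norm.tendsto_cofinite_zero
  rw [tendsto_zero_iff_norm_tendsto_zero]
  have h2 := h.sqrt
  simpa [← sq, Real.sqrt_sq] using h2

/-! ### Uniqueness for exponential sums -/

theorem tendsto_cesaro_pow {z : ℂ} (hz : ‖z‖ ≤ 1) (h1 : z ≠ 1) :
    Tendsto (fun N : ℕ => (N : ℂ)⁻¹ * ∑ n ∈ Finset.range N, z ^ n) atTop (𝓝 0) := by
  refine squeeze_zero_norm (a := fun N : ℕ => (2 / ‖z - 1‖) * (N : ℝ)⁻¹) (fun N => ?_) ?_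
  · rw [geom_sum_eq h1, norm_mul, norm_div, norm_inv, Complex.norm_natCast, mul_comm]
    gcongr
    calc ‖z ^ N - 1‖ ≤ ‖z ^ N‖ + ‖(1 : ℂ)‖ := norm_sub_le _ _
      _ ≤ 1 + 1 := by
        gcongr
        · rw [norm_pow]; exact pow_le_one₀ (norm_nonneg _) hz
        · simp
      _ = 2 := by norm_num
  · simpa using (tendsto_inv_atTop_nhds_zero_nat (𝕜 := ℝ)).const_mul (2 / ‖z - 1‖)

/-- If some coefficient is nonzero, take `j` of largest `‖z j‖` among the indices with `b j ≠ 0`.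
Dividing by `z j ^ n` and averaging over `n` kills every other term, since its ratio lies in the
closed unit disc and is not `1`, and leaves `b j`. -/
theorem eq_zero_of_tsum_mul_pow_eq_zero {κ : Type*} {b z : κ → ℂ} (hb : Summable b)
    (hz : Tendsto z cofinite (𝓝 0)) (hinj : Function.Injective z) (hne : ∀ k, z k ≠ 0)
    (h : ∀ n : ℕ, ∑' k, b k * z k ^ n = 0) (k : κ) : b k = 0 := by
  classical
  by_contra hk
  -- The maximum is attained because nodes tending to `0` leave only finitely many competitors with
  -- `‖z i‖ ≥ ‖z k‖ > 0`.
  have hfin : {i | b i ≠ 0 ∧ ‖z k‖ ≤ ‖z i‖}.Finite := by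
    have h1 : ∀ᶠ i in cofinite, ‖z i‖ < ‖z k‖ := by
      have := hz.norm
      rw [norm_zero] at this
      exact this.eventually_lt_const (norm_pos_iff.2 (hne k))
    refine Set.Finite.subset h1 fun i hi => ?_
    simpa using hi.2
  obtain ⟨j, ⟨hj, hkj⟩, hmax⟩ := Set.exists_max_image _ (fun i => ‖z i‖) hfin ⟨k, hk, le_rfl⟩
  have hle : ∀ i, b i ≠ 0 → ‖z i / z j‖ ≤ 1 := by
    intro i hi
    rw [norm_div]
    refine div_le_one_of_le₀ ?_ (norm_nonneg _)
    by_cases hik : ‖z k‖ ≤ ‖z i‖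
    · exact hmax i ⟨hi, hik⟩
    · exact (not_le.1 hik).le.trans hkj
  set a : ℕ → κ → ℂ := fun N i =>
    b i * ((N : ℂ)⁻¹ * ∑ n ∈ Finset.range N, (z i / z j) ^ n) with ha
  have hbound : ∀ N i, ‖a N i‖ ≤ ‖b i‖ := by
    intro N i
    by_cases hi : b i = 0
    · simp [ha, hi]
    rw [ha, norm_mul]
    refine mul_le_of_le_one_right (norm_nonneg _) ?_
    rw [norm_mul, norm_inv, Complex.norm_natCast]
    have h2 : ‖∑ n ∈ Finset.range N, (z i / z j) ^ n‖ ≤ N := by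
      refine (norm_sum_le _ _).trans ?_
      refine (Finset.sum_le_card_nsmul _ _ 1 fun n _ => ?_).trans (by simp)
      rw [norm_pow]
      exact pow_le_one₀ (norm_nonneg _) (hle i hi)
    rcases Nat.eq_zero_or_pos N with rfl | hN
    · simp
    · have : (0 : ℝ) < N := by exact_mod_cast hN
      rw [inv_mul_le_iff₀ this]
      simpa using h2
  have hlim : ∀ i, Tendsto (fun N => a N i) atTop (𝓝 (if i = j then b j else 0)) := by
    intro i
    split_ifs with hij
    · subst hij
      refine tendsto_const_nhds.congr' ?_
      filter_upwards [eventually_gt_atTop 0] with N hN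
      have : (N : ℂ) ≠ 0 := by exact_mod_cast hN.ne'
      simp [ha, div_self (hne i), this]
    · by_cases hi : b i = 0
      · simp [ha, hi]
      · have h3 : z i / z j ≠ 1 := fun h3 => hij (hinj ((div_eq_one_iff_eq (hne j)).1 h3))
        simpa using (tendsto_cesaro_pow (hle i hi) h3).const_mul (b i)
  have hT := tendsto_tsum_of_dominated_convergence hb.norm hlim (.of_forall hbound)
  rw [tsum_ite_eq] at hT
  refine hj (tendsto_nhds_unique hT (tendsto_const_nhds.congr fun N => ?_))
  have hs : ∀ n, Summable fun i => b i * (z i / z j) ^ n := fun n => by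
    refine Summable.of_norm_bounded hb.norm fun i => ?_
    by_cases hi : b i = 0
    · simp [hi]
    · rw [norm_mul, norm_pow]
      exact mul_le_of_le_one_right (norm_nonneg _) (pow_le_one₀ (norm_nonneg _) (hle i hi))
  have e : ∀ i, a N i = (N : ℂ)⁻¹ * ∑ n ∈ Finset.range N, b i * (z i / z j) ^ n := fun i => by
    rw [ha, ← Finset.mul_sum]; ring
  simp_rw [e]
  rw [tsum_mul_left, Summable.tsum_finsetSum fun n _ => hs n]
  symm
  refine mul_eq_zero_of_right _ (Finset.sum_eq_zero fun n _ => ?_)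
  have : ∀ i, b i * (z i / z j) ^ n = b i * z i ^ n * (z j ^ n)⁻¹ := fun i => by
    rw [div_pow]; ring
  simp_rw [this]
  rw [tsum_mul_right, h n, zero_mul]

/-- A summable family is determined by its exponential sums with distinct bounded nodes converging
to a point that is not a node. -/
theorem eq_of_tsum_mul_pow_eq {κ : Type*} {b c φ : κ → ℂ} {β : ℂ} (hb : Summable b)
    (hc : Summable c) (hφ : Tendsto φ cofinite (𝓝 β)) (hinj : Function.Injective φ)
    (hne : ∀ k, φ k ≠ β) (hle : ∀ k, ‖φ k‖ ≤ 1)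
    (h : ∀ n : ℕ, ∑' k, b k * φ k ^ n = ∑' k, c k * φ k ^ n) (k : κ) : b k = c k := by
  have hs : ∀ n, Summable fun i => (b i - c i) * φ i ^ n := fun n => by
    refine Summable.of_norm_bounded (hb.sub hc).norm fun i => ?_
    rw [norm_mul, norm_pow]
    exact mul_le_of_le_one_right (norm_nonneg _) (pow_le_one₀ (norm_nonneg _) (hle i))
  have hsb : ∀ n, Summable fun i => b i * φ i ^ n := fun n => by
    refine Summable.of_norm_bounded hb.norm fun i => ?_
    rw [norm_mul, norm_pow]
    exact mul_le_of_le_one_right (norm_nonneg _) (pow_le_one₀ (norm_nonneg _) (hle i))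
  have hsc : ∀ n, Summable fun i => c i * φ i ^ n := fun n => by
    refine Summable.of_norm_bounded hc.norm fun i => ?_
    rw [norm_mul, norm_pow]
    exact mul_le_of_le_one_right (norm_nonneg _) (pow_le_one₀ (norm_nonneg _) (hle i))
  have h0 : ∀ n : ℕ, ∑' i, (b i - c i) * φ i ^ n = 0 := fun n => by
    simp_rw [sub_mul]
    rw [Summable.tsum_sub (hsb n) (hsc n), h n, sub_self]
  -- Linear combinations of the moments allow the powers of `φ` to be replaced by powers of `φ - β`,
  -- whose nodes tend to `0` without vanishing.
  have h1 : ∀ p : Polynomial ℂ, HasSum (fun i => (b i - c i) * p.eval (φ i)) 0 := by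
    intro p
    induction p using Polynomial.induction_on' with
    | add p q hp hq => simpa [mul_add] using hp.add hq
    | monomial n a =>
      have := ((h0 n) ▸ (hs n).hasSum).mul_left a
      simp only [mul_zero] at this
      refine this.congr_fun fun i => ?_
      rw [Polynomial.eval_monomial]; ring
  refine sub_eq_zero.1 (eq_zero_of_tsum_mul_pow_eq_zero (b := fun i => b i - c i)
    (z := fun i => φ i - β) (hb.sub hc) (by simpa using hφ.sub_const β)
    (fun i j hij => hinj (sub_left_injective hij)) (fun i => sub_ne_zero.2 (hne i))
    (fun n => ?_) k)
  have := (h1 ((Polynomial.X - Polynomial.C β) ^ n)).tsum_eq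
  simpa only [Polynomial.eval_pow, Polynomial.eval_sub, Polynomial.eval_X, Polynomial.eval_C]
    using this

/-! ### Translation-invariant products of Fourier coefficients -/

/-- An additive relation on `A × UnitAddCircle` that is single-valued at `0` is contained in the
graph of a character of `A`. -/
theorem exists_addMonoidHom_of_relation {A : Type*} [AddCommGroup A]
    (R : AddSubgroup (A × UnitAddCircle)) (h : ∀ t, ((0 : A), t) ∈ R → t = 0) :
    ∃ χ : A →+ UnitAddCircle, ∀ p t, (p, t) ∈ R → χ p = t := by
  -- The first projection is injective on `R`, and the circle is divisible, hence an injective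
  -- group: the second projection extends along the first.
  obtain ⟨χ, hχ⟩ := (Module.Baer.of_divisible UnitAddCircle).extension_property_addMonoidHom
    ((AddMonoidHom.fst A UnitAddCircle).comp R.subtype)
    (by
      refine (injective_iff_map_eq_zero _).2 ?_
      rintro ⟨⟨p, t⟩, hpt⟩ hp
      obtain rfl : p = 0 := hp
      simp [h t hpt])
    ((AddMonoidHom.snd A UnitAddCircle).comp R.subtype)
  exact ⟨χ, fun p t hpt => DFunLike.congr_fun hχ ⟨(p, t), hpt⟩⟩

/-- A character of `ℤ^ι` is determined by its values on the standard basis; these values are the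
coordinates of the translation vector. -/
theorem mFourier_eq_toCircle {ι : Type*} [Fintype ι] [DecidableEq ι] (χ : (ι → ℤ) →+ UnitAddCircle)
    (p : ι → ℤ) : mFourier p (fun i => χ (Pi.single i 1)) = (χ p).toCircle := by
  have hp : χ p = ∑ i, p i • χ (Pi.single i 1) := by
    conv_lhs => rw [← Finset.univ_sum_single p]
    rw [map_sum]
    refine Finset.sum_congr rfl fun i _ => ?_
    rw [← map_zsmul, ← Pi.single_smul]
    simp
  have hs : ∀ s : Finset ι, (∏ i ∈ s, fourier (p i) (χ (Pi.single i 1)) : ℂ) =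
      (∑ i ∈ s, p i • χ (Pi.single i 1)).toCircle := by
    intro s
    induction s using Finset.induction_on with
    | empty => simp
    | insert a s ha ih =>
      rw [Finset.sum_insert ha, Finset.prod_insert ha, ih, AddCircle.toCircle_add, fourier_apply,
        Circle.coe_mul]
  rw [hp]
  exact hs _

/-- Two Hermitian families on `ℤ^ι` with the same translation-invariant products differ by a
character. -/
theorem exists_eq_mul_mFourier {ι : Type*} [Fintype ι] {F G : (ι → ℤ) → ℂ}
    (hF : ∀ p, F (-p) = conj (F p)) (hG : ∀ p, G (-p) = conj (G p))
    (h : ∀ l : List (ι → ℤ), l.sum = 0 → (l.map F).prod = (l.map G).prod) :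
    ∃ θ : UnitAddTorus ι, ∀ p, G p = F p * mFourier p θ := by
  classical
  have hnorm : ∀ p, ‖F p‖ = ‖G p‖ := by
    intro p
    have h1 := h [p, -p] (by simp)
    simp only [List.map_cons, List.map_nil, List.prod_cons, List.prod_nil, mul_one, hF, hG,
      Complex.mul_conj'] at h1
    have h2 : ‖F p‖ ^ 2 = ‖G p‖ ^ 2 := by exact_mod_cast h1
    exact (pow_left_inj₀ (norm_nonneg _) (norm_nonneg _) two_ne_zero).1 h2
  -- The pairs (frequency, phase) visible where `F` does not vanish. Each element of the generated
  -- subgroup is witnessed by a list of frequencies with nonzero product; Hermitian symmetry handles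
  -- inverses.
  set S : Set ((ι → ℤ) × UnitAddCircle) :=
    {x | F x.1 ≠ 0 ∧ G x.1 = x.2.toCircle * F x.1} with hS
  have key : ∀ x ∈ AddSubgroup.closure S, ∃ l : List (ι → ℤ), l.sum = x.1 ∧
      (l.map F).prod ≠ 0 ∧ (l.map G).prod = x.2.toCircle * (l.map F).prod := by
    intro x hx
    induction hx using AddSubgroup.closure_induction with
    | mem x hx => exact ⟨[x.1], by simp, by simpa using hx.1, by simpa using hx.2⟩
    | zero => exact ⟨[], by simp, by simp, by simp⟩
    | add x y _ _ hx hy =>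
      obtain ⟨l, h1, h2, h3⟩ := hx
      obtain ⟨m, h4, h5, h6⟩ := hy
      refine ⟨l ++ m, by simp [h1, h4], ?_, ?_⟩
      · rw [List.map_append, List.prod_append]
        exact mul_ne_zero h2 h5
      simp only [List.map_append, List.prod_append, h3, h6, Prod.snd_add, AddCircle.toCircle_add,
        Circle.coe_mul]
      ring
    | neg x _ hx =>
      obtain ⟨l, h1, h2, h3⟩ := hx
      have e : ∀ {H : (ι → ℤ) → ℂ}, (∀ p, H (-p) = conj (H p)) →
          ((l.map Neg.neg).map H).prod = conj (l.map H).prod := by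
        intro H hH
        rw [map_list_prod, List.map_map, List.map_map]
        congr 1
        exact List.map_congr_left fun p _ => hH p
      refine ⟨l.map Neg.neg, ?_, ?_, ?_⟩
      · rw [Prod.fst_neg, ← h1, List.sum_neg]
      · rw [e hF]; simpa using h2
      · rw [e hF, e hG, h3, map_mul, Prod.snd_neg, AddCircle.toCircle_neg, Circle.coe_inv_eq_conj]
  -- Over frequency `0`, the equality of products over lists of sum zero forces the phase to be
  -- trivial.
  obtain ⟨χ, hχ⟩ := exists_addMonoidHom_of_relation (AddSubgroup.closure S) fun t ht => by
    obtain ⟨l, h1, h2, h3⟩ := key _ ht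
    rw [← h l h1] at h3
    have h4 : (t.toCircle : ℂ) = 1 := (mul_eq_right₀ h2).1 h3.symm
    refine AddCircle.injective_toCircle one_ne_zero ?_
    rw [AddCircle.toCircle_zero]
    exact Circle.ext (by simpa using h4)
  refine ⟨fun i => χ (Pi.single i 1), fun p => ?_⟩
  by_cases hp : F p = 0
  · have := hnorm p
    rw [hp, norm_zero, eq_comm, norm_eq_zero] at this
    simp [hp, this]
  · have hu : ‖G p / F p‖ = 1 := by
      rw [norm_div, hnorm p, div_self]
      rw [← hnorm p]
      exact norm_ne_zero_iff.2 hp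
    obtain ⟨t, ht⟩ := (AddCircle.homeomorphCircle (T := (1 : ℝ)) one_ne_zero).surjective
      ⟨G p / F p, mem_sphere_zero_iff_norm.2 hu⟩
    rw [AddCircle.homeomorphCircle_apply] at ht
    have ht' : (t.toCircle : ℂ) = G p / F p := by rw [ht]
    have hGp : G p = t.toCircle * F p := by rw [ht', div_mul_cancel₀ _ hp]
    rw [mFourier_eq_toCircle, hχ p t (AddSubgroup.subset_closure ⟨hp, hGp⟩), hGp, mul_comm]

/-! ### A law of large numbers for bounded orthogonal variables -/

section Orthogonal

variable {Ω : Type*} [MeasurableSpace Ω] {P : Measure Ω} [IsProbabilityMeasure P]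
  {Z : ℕ → Ω → ℂ} {C : ℝ}

/-- Pythagoras in `L²(P)`: the cross terms vanish, and each diagonal term is at most `C ^ 2`. -/
theorem integral_sq_norm_sum_le_of_orthogonal (hm : ∀ i, Measurable (Z i))
    (hb : ∀ i ω, ‖Z i ω‖ ≤ C) (horth : ∀ i j, i < j → ∫ ω, Z i ω * conj (Z j ω) ∂P = 0) (N : ℕ) :
    ∫ ω, ‖∑ i ∈ Finset.range N, Z i ω‖ ^ 2 ∂P ≤ N * C ^ 2 := by
  have hbS : ∀ N ω, ‖∑ i ∈ Finset.range N, Z i ω‖ ≤ N * C := fun N ω => by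
    refine (norm_sum_le _ _).trans ?_
    simpa using Finset.sum_le_card_nsmul (Finset.range N) _ C fun i _ => hb i ω
  have hint : ∀ N, Integrable (fun ω => ‖∑ i ∈ Finset.range N, Z i ω‖ ^ 2) P := fun N =>
    Integrable.of_bound (by fun_prop) ((N * C) ^ 2) (.of_forall fun ω => by
      rw [norm_pow, norm_norm]
      gcongr
      exact hbS N ω)
  have hintZ : ∀ i j, Integrable (fun ω => Z i ω * conj (Z j ω)) P := fun i j =>
    Integrable.of_bound (by
      have := Complex.continuous_conj.measurable.comp (hm j)
      exact ((hm i).mul this).aestronglyMeasurable) (C * C) (.of_forall fun ω => by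
      rw [norm_mul, RCLike.norm_conj]
      exact mul_le_mul (hb i ω) (hb j ω) (norm_nonneg _) ((norm_nonneg _).trans (hb i ω)))
  induction N with
  | zero => simp
  | succ N ih =>
    have hcross : Integrable (fun ω => (∑ i ∈ Finset.range N, Z i ω) * conj (Z N ω)) P := by
      simp_rw [Finset.sum_mul]
      exact integrable_finsetSum _ fun i _ => hintZ i N
    have h0 : ∫ ω, ((∑ i ∈ Finset.range N, Z i ω) * conj (Z N ω)).re ∂P = 0 := by
      have h1 : ∫ ω, (∑ i ∈ Finset.range N, Z i ω) * conj (Z N ω) ∂P = 0 := by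
        simp_rw [Finset.sum_mul]
        rw [integral_finsetSum _ fun i _ => hintZ i N]
        exact Finset.sum_eq_zero fun i hi => horth i N (Finset.mem_range.1 hi)
      have h2 := integral_re hcross
      simp only [RCLike.re_to_complex] at h2
      rw [h2, h1, Complex.zero_re]
    have hZN : Integrable (fun ω => ‖Z N ω‖ ^ 2) P :=
      Integrable.of_bound (by have := hm N; fun_prop) (C ^ 2) (.of_forall fun ω => by
        rw [norm_pow, norm_norm]
        gcongr
        exact hb N ω)
    have e : ∀ ω, ‖∑ i ∈ Finset.range (N + 1), Z i ω‖ ^ 2 =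
        (‖∑ i ∈ Finset.range N, Z i ω‖ ^ 2 + ‖Z N ω‖ ^ 2) +
          2 * ((∑ i ∈ Finset.range N, Z i ω) * conj (Z N ω)).re := fun ω => by
      rw [Finset.sum_range_succ, ← Complex.normSq_eq_norm_sq, Complex.normSq_add,
        Complex.normSq_eq_norm_sq, Complex.normSq_eq_norm_sq]
    simp_rw [e]
    have hcross' : Integrable
        (fun ω => 2 * ((∑ i ∈ Finset.range N, Z i ω) * conj (Z N ω)).re) P :=
      hcross.re.const_mul 2
    have hsq : Integrable (fun ω => ‖∑ i ∈ Finset.range N, Z i ω‖ ^ 2 + ‖Z N ω‖ ^ 2) P :=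
      (hint N).add hZN
    rw [integral_add hsq hcross', integral_add (hint N) hZN, integral_const_mul, h0]
    have h3 : ∫ ω, ‖Z N ω‖ ^ 2 ∂P ≤ C ^ 2 := by
      have := integral_mono hZN (integrable_const (C ^ 2)) fun ω =>
        pow_le_pow_left₀ (norm_nonneg _) (hb N ω) 2
      simpa using this
    push_cast
    linarith

/-- The second moment bound is summable along the squares, which gives almost sure convergence
there; boundedness of the terms fills the gaps between consecutive squares. -/
theorem tendsto_average_of_orthogonal (hm : ∀ i, Measurable (Z i))
    (hb : ∀ i ω, ‖Z i ω‖ ≤ C) (horth : ∀ i j, i < j → ∫ ω, Z i ω * conj (Z j ω) ∂P = 0) :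
    ∀ᵐ ω ∂P, Tendsto (fun N : ℕ => (N : ℂ)⁻¹ * ∑ i ∈ Finset.range N, Z i ω) atTop (𝓝 0) := by
  set S : ℕ → Ω → ℂ := fun N ω => ∑ i ∈ Finset.range N, Z i ω with hS
  -- `T n` is the squared modulus of the average over `n ^ 2` terms; its mean is at most `C ^ 2 / n
  -- ^ 2`.
  set T : ℕ → Ω → ℝ := fun n ω => ‖S (n ^ 2) ω‖ ^ 2 * ((n : ℝ) ^ 4)⁻¹ with hT
  have hSm : ∀ N, Measurable (S N) := fun N => by fun_prop
  have hT0 : ∀ n ω, 0 ≤ T n ω := fun n ω => by positivity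
  have hbS : ∀ N ω, ‖S N ω‖ ≤ N * C := fun N ω => by
    refine (norm_sum_le _ _).trans ?_
    simpa using Finset.sum_le_card_nsmul (Finset.range N) _ C fun i _ => hb i ω
  have hTint : ∀ n, Integrable (T n) P := fun n =>
    (Integrable.of_bound (by have := hSm (n ^ 2); fun_prop) (((n ^ 2 : ℕ) * C) ^ 2)
      (.of_forall fun ω => by
        rw [norm_pow, norm_norm]
        gcongr
        exact hbS _ ω)).mul_const _
  have hTle : ∀ n, ∫ ω, T n ω ∂P ≤ C ^ 2 * ((n : ℝ) ^ 2)⁻¹ := fun n => by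
    rw [hT, integral_mul_const]
    have := integral_sq_norm_sum_le_of_orthogonal hm hb horth (n ^ 2)
    rcases Nat.eq_zero_or_pos n with rfl | hn
    · simp
    · have hn' : (0 : ℝ) < n := by exact_mod_cast hn
      calc _ ≤ (((n ^ 2 : ℕ) : ℝ) * C ^ 2) * ((n : ℝ) ^ 4)⁻¹ := by gcongr
        _ = C ^ 2 * ((n : ℝ) ^ 2)⁻¹ := by push_cast; field_simp
  have hsum : ∀ᵐ ω ∂P, Tendsto (fun n => T n ω) atTop (𝓝 0) := by
    have h1 : ∫⁻ ω, ∑' n, ENNReal.ofReal (T n ω) ∂P ≠ ⊤ := by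
      rw [lintegral_tsum fun n => (hTint n).1.aemeasurable.ennreal_ofReal]
      have h2 : ∀ n, ∫⁻ ω, ENNReal.ofReal (T n ω) ∂P ≤ ENNReal.ofReal (C ^ 2 * ((n : ℝ) ^ 2)⁻¹) :=
        fun n => by
          rw [← ofReal_integral_eq_lintegral_ofReal (hTint n) (.of_forall (hT0 n))]
          exact ENNReal.ofReal_le_ofReal (hTle n)
      refine ne_top_of_le_ne_top ?_ (ENNReal.tsum_le_tsum h2)
      exact ((Real.summable_nat_pow_inv.2 one_lt_two).mul_left (C ^ 2)).tsum_ofReal_ne_top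
    have h3 : AEMeasurable (fun ω => ∑' n, ENNReal.ofReal (T n ω)) P :=
      AEMeasurable.tsum fun n => (hTint n).1.aemeasurable.ennreal_ofReal
    filter_upwards [ae_lt_top' h3 h1] with ω hω
    have h4 := ENNReal.tendsto_atTop_zero_of_tsum_ne_top hω.ne
    have h5 := (ENNReal.tendsto_toReal ENNReal.zero_ne_top).comp h4
    simpa [Function.comp_def, hT0] using h5
  filter_upwards [hsum] with ω hω
  have h1 : Tendsto (fun n : ℕ => ‖S (n ^ 2) ω‖ * ((n : ℝ) ^ 2)⁻¹ + 2 * C * (n : ℝ)⁻¹) atTop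
      (𝓝 0) := by
    have h2 := hω.sqrt
    have h3 := (tendsto_inv_atTop_nhds_zero_nat (𝕜 := ℝ)).const_mul (2 * C)
    have h4 := h2.add h3
    simp only [Real.sqrt_zero, mul_zero, add_zero] at h4
    refine h4.congr fun n => ?_
    congr 1
    rw [hT]
    have : ‖S (n ^ 2) ω‖ ^ 2 * ((n : ℝ) ^ 4)⁻¹ = (‖S (n ^ 2) ω‖ * ((n : ℝ) ^ 2)⁻¹) ^ 2 := by
      rw [mul_pow, inv_pow, ← pow_mul]
    simp only [this]
    exact Real.sqrt_sq (by positivity)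
  have hsqrt : Tendsto Nat.sqrt atTop atTop :=
    tendsto_atTop.2 fun b => by
      filter_upwards [eventually_ge_atTop (b * b)] with N hN
      exact Nat.le_sqrt.2 hN
  refine squeeze_zero_norm' ?_ (h1.comp hsqrt)
  filter_upwards [eventually_ge_atTop 1] with N hN
  -- At most `2 * n` terms separate `n ^ 2` from `N`, so they change the average by at most `2 * C /
  -- n`.
  set n := Nat.sqrt N with hn
  have hn1 : 1 ≤ n := Nat.le_sqrt.2 (by simpa using hN)
  have hnN : n ^ 2 ≤ N := by rw [sq]; exact Nat.sqrt_le N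
  have hNn : N ≤ n ^ 2 + 2 * n := by have := Nat.sqrt_le_add N; rw [← hn] at this; nlinarith
  have hn' : (0 : ℝ) < n := by exact_mod_cast hn1
  have hC : 0 ≤ C := (norm_nonneg _).trans (hb 0 ω)
  have hdiff : ‖S N ω‖ ≤ ‖S (n ^ 2) ω‖ + 2 * n * C := by
    have e : S N ω = S (n ^ 2) ω + ∑ i ∈ Finset.Ico (n ^ 2) N, Z i ω :=
      (Finset.sum_range_add_sum_Ico _ hnN).symm
    rw [e]
    refine (norm_add_le _ _).trans (add_le_add_right ?_ _)
    refine (norm_sum_le _ _).trans ((Finset.sum_le_card_nsmul _ _ C fun i _ => hb i ω).trans ?_)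
    rw [Nat.card_Ico, nsmul_eq_mul]
    gcongr
    have : N - n ^ 2 ≤ 2 * n := by omega
    exact_mod_cast this
  have hnN' : (n : ℝ) ^ 2 ≤ N := by exact_mod_cast hnN
  rw [norm_mul, norm_inv, Complex.norm_natCast]
  calc (N : ℝ)⁻¹ * ‖S N ω‖ ≤ ((n : ℝ) ^ 2)⁻¹ * (‖S (n ^ 2) ω‖ + 2 * n * C) := by gcongr
    _ = ‖S (n ^ 2) ω‖ * ((n : ℝ) ^ 2)⁻¹ + 2 * C * (n : ℝ)⁻¹ := by field_simp

end Orthogonal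

/-! ### Random walks on the torus -/

section Walk

variable {Ω : Type*} [MeasurableSpace Ω] {ι : Type*} [Fintype ι]

/-- The variables `ξ n` are independent with common law `ρ`. -/
structure IsIIDSteps (ξ : ℕ → Ω → UnitAddTorus ι) (P : Measure Ω)
    (ρ : Measure (UnitAddTorus ι)) : Prop where
  measurable : ∀ n, Measurable (ξ n)
  indep : iIndepFun ξ P
  map_eq : ∀ n, P.map (ξ n) = ρ

/-- The walk started at `0` with steps `ξ`. -/
def walk (ξ : ℕ → Ω → UnitAddTorus ι) (n : ℕ) (ω : Ω) : UnitAddTorus ι :=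
  ∑ l ∈ Finset.range n, ξ l ω

/-- The σ-algebra generated by the steps with index in `S`. -/
@[reducible] def stepAlgebra (ξ : ℕ → Ω → UnitAddTorus ι) (S : Set ℕ) : MeasurableSpace Ω :=
  ⨆ l ∈ S, MeasurableSpace.comap (ξ l) inferInstance

/-- The Fourier transform of a measure on the torus, with the sign convention `e^{2πi k·x}`. -/
def charCoeff (ρ : Measure (UnitAddTorus ι)) (k : ι → ℤ) : ℂ := ∫ x, mFourier k x ∂ρ

theorem norm_charCoeff_le (ρ : Measure (UnitAddTorus ι)) [IsProbabilityMeasure ρ] (k : ι → ℤ) :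
    ‖charCoeff ρ k‖ ≤ 1 := by
  have := norm_integral_le_of_norm_le_const (μ := ρ) (f := fun x => mFourier k x) (C := 1)
    (.of_forall fun x => (norm_mFourier_apply k x).le)
  simpa [charCoeff] using this

variable {ξ : ℕ → Ω → UnitAddTorus ι} {P : Measure Ω} {ρ : Measure (UnitAddTorus ι)}

theorem measurable_stepAlgebra {S : Set ℕ} {l : ℕ} (hl : l ∈ S) :
    Measurable[stepAlgebra ξ S] (ξ l) :=
  Measurable.of_comap_le (le_iSup₂_of_le l hl le_rfl)

theorem measurable_walk_stepAlgebra {S : Set ℕ} {n : ℕ} (hS : ∀ l < n, l ∈ S) :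
    Measurable[stepAlgebra ξ S] (walk ξ n) :=
  Finset.measurable_sum _ fun l hl => measurable_stepAlgebra (hS l (Finset.mem_range.1 hl))

theorem measurable_mFourier (k : ι → ℤ) : Measurable fun x : UnitAddTorus ι => mFourier k x :=
  (map_continuous (mFourier k)).measurable

theorem walk_add (n m : ℕ) (ω : Ω) :
    walk ξ (n + m) ω = walk ξ n ω + ∑ l ∈ Finset.range m, ξ (n + l) ω := by
  rw [walk, Finset.sum_range_add]; rfl

namespace IsIIDSteps

variable (h : IsIIDSteps ξ P ρ)

include h

theorem isProbabilityMeasure [IsProbabilityMeasure P] : IsProbabilityMeasure ρ := by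
  rw [← h.map_eq 0]
  exact Measure.isProbabilityMeasure_map (h.measurable 0).aemeasurable

theorem stepAlgebra_le (S : Set ℕ) : stepAlgebra ξ S ≤ ‹MeasurableSpace Ω› :=
  iSup₂_le fun l _ => (h.measurable l).comap_le

theorem measurable_walk (n : ℕ) : Measurable (walk ξ n) :=
  Finset.measurable_sum _ fun l _ => h.measurable l

theorem indepFun_of_disjoint {E F : Type*} [MeasurableSpace E] [MeasurableSpace F] {S T : Set ℕ}
    (hST : Disjoint S T) {U : Ω → E} {V : Ω → F} (hU : Measurable[stepAlgebra ξ S] U)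
    (hV : Measurable[stepAlgebra ξ T] V) : IndepFun U V P := by
  rw [IndepFun_iff_Indep]
  have := indep_iSup_of_disjoint (fun l => (h.measurable l).comap_le) h.indep hST
  exact indep_of_indep_of_le_left (indep_of_indep_of_le_right this hV.comap_le) hU.comap_le

theorem integral_mFourier_step (k : ι → ℤ) (n : ℕ) :
    ∫ ω, mFourier k (ξ n ω) ∂P = charCoeff ρ k := by
  rw [charCoeff, ← h.map_eq n, integral_map (h.measurable n).aemeasurable
    (measurable_mFourier k).aestronglyMeasurable]

theorem integral_prod_mFourier_step [IsProbabilityMeasure P] (r : ℕ → ι → ℤ) (m : ℕ) :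
    ∫ ω, ∏ l ∈ Finset.range m, mFourier (r l) (ξ l ω) ∂P =
      ∏ l ∈ Finset.range m, charCoeff ρ (r l) := by
  induction m with
  | zero => simp
  | succ m ih =>
    simp_rw [Finset.prod_range_succ]
    have hi : IndepFun (fun ω => ∏ l ∈ Finset.range m, mFourier (r l) (ξ l ω))
        (fun ω => mFourier (r m) (ξ m ω)) P := by
      refine h.indepFun_of_disjoint (S := Set.Iio m) (T := {m}) (by simp) ?_ ?_
      · exact Finset.measurable_prod _ fun l hl => (measurable_mFourier _).comp
          (measurable_stepAlgebra (Finset.mem_range.1 hl))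
      · exact (measurable_mFourier _).comp (measurable_stepAlgebra (Set.mem_singleton _))
    rw [hi.integral_fun_mul_eq_mul_integral, ih, h.integral_mFourier_step]
    · exact (Finset.measurable_prod _ fun l _ => (measurable_mFourier _).comp
        (h.measurable l)).aestronglyMeasurable
    · exact ((measurable_mFourier _).comp (h.measurable m)).aestronglyMeasurable

/-- The factor `W i` depends only on steps before `i + m`, so it multiplies an independent centred
variable. Distinct terms are therefore orthogonal. -/
theorem tendsto_average_martingale_difference [IsProbabilityMeasure P] {W : ℕ → Ω → ℂ} (m : ℕ)
    (r : ι → ℤ) (hW : ∀ i, Measurable[stepAlgebra ξ (Set.Iio (i + m))] (W i))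
    (hb : ∀ i ω, ‖W i ω‖ ≤ 1) :
    ∀ᵐ ω ∂P, Tendsto (fun N : ℕ => (N : ℂ)⁻¹ * ∑ i ∈ Finset.range N,
      W i ω * (mFourier r (ξ (i + m) ω) - charCoeff ρ r)) atTop (𝓝 0) := by
  have := h.isProbabilityMeasure
  have hη : ∀ n, Measurable fun ω => mFourier r (ξ n ω) - charCoeff ρ r := fun n =>
    ((measurable_mFourier r).comp (h.measurable n)).sub_const _
  have hWm : ∀ i, Measurable (W i) := fun i => (hW i).mono (h.stepAlgebra_le _) le_rfl
  refine tendsto_average_of_orthogonal (C := 2) (fun i => (hWm i).mul (hη _)) (fun i ω => ?_) ?_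
  · rw [norm_mul]
    have h1 : ‖mFourier r (ξ (i + m) ω) - charCoeff ρ r‖ ≤ 1 + 1 :=
      (norm_sub_le _ _).trans (add_le_add (norm_mFourier_apply _ _).le (norm_charCoeff_le ρ r))
    calc _ ≤ 1 * (1 + 1 : ℝ) := mul_le_mul (hb i ω) h1 (norm_nonneg _) zero_le_one
      _ = 2 := by norm_num
  · intro i j hij
    set U : Ω → ℂ := fun ω =>
      W i ω * (mFourier r (ξ (i + m) ω) - charCoeff ρ r) * conj (W j ω) with hU
    set V : Ω → ℂ := fun ω => conj (mFourier r (ξ (j + m) ω) - charCoeff ρ r) with hV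
    have hUm : Measurable[stepAlgebra ξ (Set.Iio (j + m))] U := by
      have h1 : Measurable[stepAlgebra ξ (Set.Iio (j + m))] (W i) :=
        (hW i).mono (biSup_mono fun l hl => (Set.mem_Iio.1 hl).trans_le (by omega)) le_rfl
      have h2 : Measurable[stepAlgebra ξ (Set.Iio (j + m))] (ξ (i + m)) :=
        measurable_stepAlgebra (by simpa using hij)
      exact (h1.mul (((measurable_mFourier r).comp h2).sub_const _)).mul
        (Complex.continuous_conj.measurable.comp (hW j))
    have hVm : Measurable[stepAlgebra ξ {j + m}] V := by
      have h1 : Measurable[stepAlgebra ξ {j + m}] (ξ (j + m)) :=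
        measurable_stepAlgebra (Set.mem_singleton _)
      exact Complex.continuous_conj.measurable.comp
        (((measurable_mFourier r).comp h1).sub_const _)
    have hind : IndepFun U V P := h.indepFun_of_disjoint (by simp) hUm hVm
    have hV0 : ∫ ω, V ω ∂P = 0 := by
      have h1 : ∫ ω, (mFourier r (ξ (j + m) ω) - charCoeff ρ r) ∂P = 0 := by
        have h2 : Integrable (fun ω => mFourier r (ξ (j + m) ω)) P := Integrable.of_bound
          ((measurable_mFourier r).comp (h.measurable _)).aestronglyMeasurable 1
          (.of_forall fun ω => (norm_mFourier_apply _ _).le)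
        rw [integral_sub h2 (integrable_const _), h.integral_mFourier_step]
        simp
      exact (integral_conj (f := fun ω => mFourier r (ξ (j + m) ω) - charCoeff ρ r)).trans
        (by rw [h1, map_zero])
    have e : ∫ ω, U ω * V ω ∂P = 0 := by
      rw [hind.integral_fun_mul_eq_mul_integral
        (hUm.mono (h.stepAlgebra_le _) le_rfl).aestronglyMeasurable
        (hVm.mono (h.stepAlgebra_le _) le_rfl).aestronglyMeasurable, hV0, mul_zero]
    rw [← e]
    refine integral_congr_ae (.of_forall fun ω => ?_)
    simp only [hU, hV, map_mul]
    ring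

/-- For `K ≠ 0`, the increments of `mFourier K` along the walk telescope to a bounded quantity. Each
increment is a martingale difference minus `1 - φ` times the current value, so the average tends to
`0` because `φ ≠ 1`. -/
theorem tendsto_average_mFourier_walk [IsProbabilityMeasure P] (K : ι → ℤ)
    (hK : K ≠ 0 → charCoeff ρ K ≠ 1) :
    ∀ᵐ ω ∂P, Tendsto (fun N : ℕ => (N : ℂ)⁻¹ * ∑ i ∈ Finset.range N, mFourier K (walk ξ i ω)) atTop
      (𝓝 (if K = 0 then 1 else 0)) := by
  split_ifs with h0
  · refine .of_forall fun ω => tendsto_const_nhds.congr' ?_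
    filter_upwards [eventually_gt_atTop 0] with N hN
    have : (N : ℂ) ≠ 0 := by exact_mod_cast hN.ne'
    simp [h0, mFourier_zero, this]
  · have h1 := h.tendsto_average_martingale_difference (W := fun i ω => mFourier K (walk ξ i ω))
      0 K (fun i => (measurable_mFourier K).comp (measurable_walk_stepAlgebra fun l hl => hl))
      (fun i ω => (norm_mFourier_apply _ _).le)
    filter_upwards [h1] with ω hω
    set φ := charCoeff ρ K
    have hφ : 1 - φ ≠ 0 := sub_ne_zero.2 (hK h0).symm
    have h2 : Tendsto (fun N : ℕ => (N : ℂ)⁻¹ * (mFourier K (walk ξ N ω) - 1)) atTop (𝓝 0) := by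
      refine squeeze_zero_norm (a := fun N : ℕ => (N : ℝ)⁻¹ * 2) (fun N => ?_) ?_
      · rw [norm_mul, norm_inv, Complex.norm_natCast]
        gcongr
        refine (norm_sub_le _ _).trans ?_
        rw [norm_mFourier_apply, norm_one]
        norm_num
      · simpa using (tendsto_inv_atTop_nhds_zero_nat (𝕜 := ℝ)).mul_const 2
    have h3 := (hω.sub h2).const_mul (1 - φ)⁻¹
    rw [sub_zero, mul_zero] at h3
    refine h3.congr fun N => ?_
    have h4 : ∑ i ∈ Finset.range N, mFourier K (walk ξ i ω) * (mFourier K (ξ (i + 0) ω) - φ) =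
        (1 - φ) * ∑ i ∈ Finset.range N, mFourier K (walk ξ i ω) +
          (mFourier K (walk ξ N ω) - 1) := by
      have h5 : ∑ i ∈ Finset.range N, (mFourier K (walk ξ (i + 1) ω) - mFourier K (walk ξ i ω)) =
          mFourier K (walk ξ N ω) - 1 := by
        rw [Finset.sum_range_sub (fun i => mFourier K (walk ξ i ω))]
        simp [walk, mFourier_apply_zero]
      rw [← h5, Finset.mul_sum, ← Finset.sum_add_distrib]
      refine Finset.sum_congr rfl fun i _ => ?_
      rw [walk_add, mFourier_apply_add]
      simp only [add_zero, Finset.range_one, Finset.sum_singleton]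
      ring
    rw [h4, mul_add, add_sub_cancel_right, mul_left_comm, inv_mul_cancel_left₀ hφ]

/-- Induction on the block length: replacing the character of the last step by its mean costs a
martingale difference, whose average vanishes. -/
theorem tendsto_average_mFourier_block [IsProbabilityMeasure P]
    (hφ : ∀ k, k ≠ 0 → charCoeff ρ k ≠ 1) (K : ι → ℤ) (r : ℕ → ι → ℤ) (m : ℕ) :
    ∀ᵐ ω ∂P, Tendsto (fun N : ℕ => (N : ℂ)⁻¹ * ∑ i ∈ Finset.range N,
      (mFourier K (walk ξ i ω) * ∏ l ∈ Finset.range m, mFourier (r l) (ξ (i + l) ω))) atTop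
      (𝓝 ((if K = 0 then 1 else 0) * ∏ l ∈ Finset.range m, charCoeff ρ (r l))) := by
  induction m with
  | zero => simpa using h.tendsto_average_mFourier_walk K (hφ K)
  | succ m ih =>
    have h1 := h.tendsto_average_martingale_difference (W := fun i ω =>
      mFourier K (walk ξ i ω) * ∏ l ∈ Finset.range m, mFourier (r l) (ξ (i + l) ω)) m (r m)
      (fun i => by
        refine ((measurable_mFourier K).comp (measurable_walk_stepAlgebra fun l hl => ?_)).mul
          (Finset.measurable_prod _ fun l hl => (measurable_mFourier _).comp
            (measurable_stepAlgebra ?_))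
        · exact Set.mem_Iio.2 (by omega)
        · have := Finset.mem_range.1 hl
          exact Set.mem_Iio.2 (by omega))
      (fun i ω => by simp [norm_prod, norm_mFourier_apply])
    filter_upwards [ih, h1] with ω hω hω1
    have h2 := hω1.add (hω.mul_const (charCoeff ρ (r m)))
    rw [zero_add, mul_assoc, ← Finset.prod_range_succ] at h2
    refine h2.congr fun N => ?_
    rw [mul_assoc, ← mul_add, Finset.sum_mul, ← Finset.sum_add_distrib]
    congr 1
    refine Finset.sum_congr rfl fun i _ => ?_
    rw [Finset.prod_range_succ]
    ring

end IsIIDSteps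

/-- The step `i + l` enters the position at time `i + s j` exactly when `l < s j`. Regrouping by
steps turns dependent positions into a product over independent steps. -/
theorem prod_mFourier_walk {J : Type*} [Fintype J] (s : J → ℕ) (k : J → ι → ℤ) {m : ℕ}
    (hm : ∀ j, s j ≤ m) (i : ℕ) (ω : Ω) :
    ∏ j, mFourier (k j) (walk ξ (i + s j) ω) = mFourier (∑ j, k j) (walk ξ i ω) *
      ∏ l ∈ Finset.range m, mFourier (∑ j with l < s j, k j) (ξ (i + l) ω) := by
  simp_rw [walk_add, mFourier_apply_add, Finset.prod_mul_distrib, mFourier_finset_sum,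
    mFourier_apply_finset_sum]
  congr 1
  simp_rw [Finset.prod_filter]
  rw [Finset.prod_comm]
  refine Finset.prod_congr rfl fun j _ => ?_
  rw [← Finset.prod_filter]
  refine Finset.prod_congr ?_ fun _ _ => rfl
  ext l
  have := hm j
  simp only [Finset.mem_range, Finset.mem_filter]
  omega

end Walk

/-! ### Weyl's criterion for a general limit measure -/

section Weyl

variable {κ : Type*} [Fintype κ]

/-- Trigonometric polynomials are uniformly dense, and averaging and integration are both
contractions for the uniform norm. -/
theorem tendsto_average_of_tendsto_average_mFourier {z : ℕ → UnitAddTorus κ}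
    {μ : Measure (UnitAddTorus κ)} [IsProbabilityMeasure μ]
    (h : ∀ k, Tendsto (fun N : ℕ => (N : ℂ)⁻¹ * ∑ i ∈ Finset.range N, mFourier k (z i)) atTop
      (𝓝 (∫ x, mFourier k x ∂μ))) (F : C(UnitAddTorus κ, ℂ)) :
    Tendsto (fun N : ℕ => (N : ℂ)⁻¹ * ∑ i ∈ Finset.range N, F (z i)) atTop (𝓝 (∫ x, F x ∂μ)) := by
  have hint : ∀ G : C(UnitAddTorus κ, ℂ), Integrable (fun x => G x) μ := fun G =>
    Integrable.of_bound (map_continuous G).aestronglyMeasurable ‖G‖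
      (.of_forall fun x => G.norm_coe_le_norm x)
  have hspan : ∀ G ∈ Submodule.span ℂ (Set.range (mFourier (d := κ))),
      Tendsto (fun N : ℕ => (N : ℂ)⁻¹ * ∑ i ∈ Finset.range N, G (z i)) atTop
        (𝓝 (∫ x, G x ∂μ)) := by
    intro G hG
    induction hG using Submodule.span_induction with
    | mem G hG => obtain ⟨k, rfl⟩ := hG; exact h k
    | zero => simp
    | add G H _ _ hG hH =>
      have := hG.add hH
      simpa only [ContinuousMap.add_apply, Finset.sum_add_distrib, mul_add,
        integral_add (hint G) (hint H)] using this
    | smul c G _ hG =>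
      have := hG.const_mul c
      simp only [ContinuousMap.smul_apply, smul_eq_mul, integral_const_mul, ← Finset.mul_sum]
      refine this.congr fun N => by ring
  have hF : F ∈ closure (Submodule.span ℂ (Set.range (mFourier (d := κ))) :
      Set C(UnitAddTorus κ, ℂ)) := by
    have := span_mFourier_closure_eq_top (d := κ)
    rw [← Submodule.topologicalClosure_coe, this]
    trivial
  rw [Metric.tendsto_atTop]
  intro ε hε
  obtain ⟨G, hG, hFG⟩ := Metric.mem_closure_iff.1 hF (ε / 3) (by positivity)
  obtain ⟨N₀, hN₀⟩ := Metric.tendsto_atTop.1 (hspan G hG) (ε / 3) (by positivity)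
  refine ⟨N₀, fun N hN => ?_⟩
  have h1 := hN₀ N hN
  have hpt : ∀ x, ‖F x - G x‖ ≤ dist F G := fun x => by
    rw [← dist_eq_norm]; exact ContinuousMap.dist_apply_le_dist x
  have h2 : dist ((N : ℂ)⁻¹ * ∑ i ∈ Finset.range N, F (z i))
      ((N : ℂ)⁻¹ * ∑ i ∈ Finset.range N, G (z i)) ≤ dist F G := by
    rw [dist_eq_norm, ← mul_sub, ← Finset.sum_sub_distrib, norm_mul, norm_inv,
      Complex.norm_natCast]
    have h3 : ‖∑ i ∈ Finset.range N, (F (z i) - G (z i))‖ ≤ N * dist F G := by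
      refine (norm_sum_le _ _).trans ?_
      simpa using Finset.sum_le_card_nsmul (Finset.range N) _ (dist F G) fun i _ => hpt (z i)
    rcases Nat.eq_zero_or_pos N with rfl | hN'
    · simp
    · rwa [inv_mul_le_iff₀ (by exact_mod_cast hN')]
  have h4 : dist (∫ x, G x ∂μ) (∫ x, F x ∂μ) ≤ dist F G := by
    rw [dist_comm, dist_eq_norm, ← integral_sub (hint F) (hint G)]
    simpa using norm_integral_le_of_norm_le_const (μ := μ) (.of_forall hpt)
  calc _ ≤ _ := dist_triangle4 _ ((N : ℂ)⁻¹ * ∑ i ∈ Finset.range N, G (z i)) (∫ x, G x ∂μ) _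
    _ < ε / 3 + ε / 3 + ε / 3 := by
      gcongr
      · exact h2.trans_lt hFG
      · exact h4.trans_lt hFG
    _ = ε := by ring

theorem tendsto_average_indicator_of_tendsto_average_mFourier {z : ℕ → UnitAddTorus κ}
    {μ : Measure (UnitAddTorus κ)} [IsProbabilityMeasure μ]
    (h : ∀ k, Tendsto (fun N : ℕ => (N : ℂ)⁻¹ * ∑ i ∈ Finset.range N, mFourier k (z i)) atTop
      (𝓝 (∫ x, mFourier k x ∂μ))) {s : Set (UnitAddTorus κ)} (hs : μ (frontier s) = 0) :
    Tendsto (fun N : ℕ => (N : ℝ)⁻¹ * ∑ i ∈ Finset.range N, s.indicator (fun _ => (1 : ℝ)) (z i)) atTop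
      (𝓝 (μ.real s)) := by
  -- The empirical measure of `N + 1` points: the shift avoids the empty average, which is not a
  -- probability measure.
  have hprob : ∀ N : ℕ, IsProbabilityMeasure
      (((N + 1 : ℕ) : ENNReal)⁻¹ • ∑ i ∈ Finset.range (N + 1), Measure.dirac (z i)) := fun N => by
    constructor
    simp only [Measure.smul_apply, Measure.finsetSum_apply, measure_univ, Finset.sum_const,
      Finset.card_range, nsmul_eq_mul, mul_one, smul_eq_mul]
    exact ENNReal.inv_mul_cancel (by simp) (ENNReal.natCast_ne_top _)
  set ν : ℕ → ProbabilityMeasure (UnitAddTorus κ) := fun N => ⟨_, hprob N⟩ with hν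
  set ν' : ProbabilityMeasure (UnitAddTorus κ) := ⟨μ, inferInstance⟩ with hν'
  have hlim : Tendsto ν atTop (𝓝 ν') := by
    rw [ProbabilityMeasure.tendsto_iff_forall_integral_rclike_tendsto ℂ]
    intro f
    have h1 := (tendsto_add_atTop_iff_nat 1).2
      (tendsto_average_of_tendsto_average_mFourier h f.toContinuousMap)
    refine h1.congr fun N => ?_
    simp only [hν, ProbabilityMeasure.coe_mk]
    rw [integral_smul_measure, integral_finsetSum_measure]
    · simp only [integral_dirac, ENNReal.toReal_inv, ENNReal.toReal_natCast, Complex.real_smul,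
        Complex.ofReal_inv, Complex.ofReal_natCast]
      rfl
    · exact fun i _ => integrable_dirac (by simp)
  have h2 := ProbabilityMeasure.tendsto_measure_of_null_frontier_of_tendsto hlim (E := s)
    ((ProbabilityMeasure.null_iff_toMeasure_null ν' _).2 hs)
  have h3 := (NNReal.tendsto_coe.2 h2)
  refine (tendsto_add_atTop_iff_nat 1).1 (h3.congr fun N => ?_)
  have h4 : ((ν N s : ℝ≥0) : ℝ) = (ν N : Measure (UnitAddTorus κ)).real s := rfl
  rw [h4]
  simp only [hν, ProbabilityMeasure.coe_mk, measureReal_def, Measure.smul_apply,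
    Measure.finsetSum_apply, smul_eq_mul, ENNReal.toReal_mul, ENNReal.toReal_inv,
    ENNReal.toReal_natCast, Measure.dirac_apply]
  congr 1
  rw [ENNReal.toReal_sum]
  · refine Finset.sum_congr rfl fun i _ => ?_
    by_cases hi : z i ∈ s <;> simp [hi]
  · intro i _
    by_cases hi : z i ∈ s <;> simp [hi]

theorem frontier_iInter_subset_iUnion_frontier {X J : Type*} [TopologicalSpace X] [Finite J]
    (s : J → Set X) : frontier (⋂ j, s j) ⊆ ⋃ j, frontier (s j) := by
  rintro x ⟨hx, hx'⟩
  by_contra hn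
  rw [Set.mem_iUnion, not_exists] at hn
  refine hx' ?_
  rw [interior_iInter_of_finite, Set.mem_iInter]
  intro j
  by_contra hj
  exact hn j ⟨closure_mono (Set.iInter_subset s j) hx, hj⟩

end Weyl

/-! ### Joint statistics of the walk started from the uniform distribution -/

section Tuple

variable {Ω : Type*} [MeasurableSpace Ω] {ι : Type*} [Fintype ι] {J : Type*} [Fintype J]

/-- The positions `x + Y (i + s j)` of the walk started at `x`, as a point of a larger torus. -/
def tuple (ξ : ℕ → Ω → UnitAddTorus ι) (s : J → ℕ) (i : ℕ) (x : UnitAddTorus ι) (ω : Ω) :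
    UnitAddTorus (J × ι) :=
  fun p => (x + walk ξ (i + s p.1) ω) p.2

/-- The law of the positions at the times `s j` of the walk started from the uniform
distribution. -/
def tupleLaw (ξ : ℕ → Ω → UnitAddTorus ι) (P : Measure Ω) (s : J → ℕ) :
    Measure (UnitAddTorus (J × ι)) :=
  ((haarTorus ι).prod P).map fun y => tuple ξ s 0 y.1 y.2

theorem mFourier_tuple (ξ : ℕ → Ω → UnitAddTorus ι) (s : J → ℕ) (i : ℕ) (x : UnitAddTorus ι)
    (ω : Ω) (k : J × ι → ℤ) :
    mFourier k (tuple ξ s i x ω) = mFourier (∑ j, fun a => k (j, a)) x *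
      ∏ j, mFourier (fun a => k (j, a)) (walk ξ (i + s j) ω) := by
  rw [mFourier_finset_sum, ← Finset.prod_mul_distrib]
  simp_rw [← mFourier_apply_add]
  simp only [mFourier, ContinuousMap.coe_mk, tuple]
  exact Fintype.prod_prod_type _

variable {ξ : ℕ → Ω → UnitAddTorus ι} {P : Measure Ω} {ρ : Measure (UnitAddTorus ι)}

namespace IsIIDSteps

variable (h : IsIIDSteps ξ P ρ) [IsProbabilityMeasure P]

include h

omit [IsProbabilityMeasure P] in
theorem measurable_tuple (s : J → ℕ) (i : ℕ) :
    Measurable fun y : UnitAddTorus ι × Ω => tuple ξ s i y.1 y.2 := by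
  refine measurable_pi_lambda _ fun p => ?_
  exact (measurable_pi_apply p.2).comp
    (measurable_fst.add ((h.measurable_walk _).comp measurable_snd))

theorem isProbabilityMeasure_tupleLaw (s : J → ℕ) : IsProbabilityMeasure (tupleLaw ξ P s) :=
  Measure.isProbabilityMeasure_map (h.measurable_tuple s 0).aemeasurable

theorem integral_mFourier_tupleLaw (s : J → ℕ) {m : ℕ} (hm : ∀ j, s j ≤ m) (k : J × ι → ℤ) :
    ∫ z, mFourier k z ∂tupleLaw ξ P s = (if (∑ j, fun a => k (j, a)) = 0 then 1 else 0) *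
      ∏ l ∈ Finset.range m, charCoeff ρ (∑ j with l < s j, fun a => k (j, a)) := by
  rw [tupleLaw, integral_map (h.measurable_tuple s 0).aemeasurable
    (measurable_mFourier k).aestronglyMeasurable]
  simp_rw [mFourier_tuple]
  rw [integral_prod_mul (fun x => mFourier (∑ j, fun a => k (j, a)) x)
    (fun ω => ∏ j, mFourier (fun a => k (j, a)) (walk ξ (0 + s j) ω)), integral_mFourier]
  congr 1
  simp_rw [prod_mFourier_walk s (fun j a => k (j, a)) hm 0, zero_add]
  simp only [walk, Finset.range_zero, Finset.sum_empty, mFourier_apply_zero, one_mul]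
  exact h.integral_prod_mFourier_step _ m

/-- The starting point enters only through the character of frequency `∑ j, k j`. This is `1` when
that sum is zero, and otherwise the limit is `0`. Hence one null set serves all starting points. -/
theorem tendsto_average_mFourier_tuple (hφ : ∀ k, k ≠ 0 → charCoeff ρ k ≠ 1) (s : J → ℕ) :
    ∀ᵐ ω ∂P, ∀ (x : UnitAddTorus ι) (k : J × ι → ℤ),
      Tendsto (fun N : ℕ => (N : ℂ)⁻¹ * ∑ i ∈ Finset.range N, mFourier k (tuple ξ s i x ω)) atTop
        (𝓝 (∫ z, mFourier k z ∂tupleLaw ξ P s)) := by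
  obtain ⟨m, hm⟩ : ∃ m, ∀ j, s j ≤ m :=
    ⟨Finset.univ.sup s, fun j => Finset.le_sup (Finset.mem_univ j)⟩
  have h1 := ae_all_iff.2 fun k : J × ι → ℤ => h.tendsto_average_mFourier_block hφ
    (∑ j, fun a => k (j, a)) (fun l => ∑ j with l < s j, fun a => k (j, a)) m
  filter_upwards [h1] with ω hω x k
  rw [h.integral_mFourier_tupleLaw s hm k]
  have h2 := (hω k).const_mul (mFourier (∑ j, fun a => k (j, a)) x)
  have h3 : ∀ c : ℂ, mFourier (∑ j, fun a => k (j, a)) x *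
      ((if (∑ j, fun a => k (j, a)) = 0 then 1 else 0) * c) =
      (if (∑ j, fun a => k (j, a)) = 0 then 1 else 0) * c := fun c => by
    split_ifs with h0
    · rw [h0, mFourier_zero]; simp
    · simp
  rw [h3] at h2
  refine h2.congr fun N => ?_
  rw [mul_left_comm, Finset.mul_sum]
  congr 1
  refine Finset.sum_congr rfl fun i _ => ?_
  rw [mFourier_tuple, prod_mFourier_walk s (fun j a => k (j, a)) hm i]

/-- Haar measure is stationary for the walk. This makes the boundary of the product event null under
the joint law. -/
theorem tupleLaw_preimage_eval (s : J → ℕ) (j : J) {A : Set (UnitAddTorus ι)}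
    (hA : MeasurableSet A) :
    tupleLaw ξ P s {z | (fun a => z (j, a)) ∈ A} = haarTorus ι A := by
  have hm : Measurable fun z : UnitAddTorus (J × ι) => (fun a => z (j, a) : UnitAddTorus ι) :=
    measurable_pi_lambda _ fun a => measurable_pi_apply _
  have hA' : MeasurableSet {z : UnitAddTorus (J × ι) | (fun a => z (j, a)) ∈ A} := hm hA
  rw [tupleLaw, Measure.map_apply (h.measurable_tuple s 0) hA',
    Measure.prod_apply_symm (h.measurable_tuple s 0 hA')]
  have e : ∀ ω, haarTorus ι ((fun x => (x, ω)) ⁻¹' ((fun y : UnitAddTorus ι × Ω =>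
      tuple ξ s 0 y.1 y.2) ⁻¹' {z | (fun a => z (j, a)) ∈ A})) = haarTorus ι A := fun ω =>
    measure_preimage_add_right (haarTorus ι) (walk ξ (0 + s j) ω) A
  simp_rw [e]
  simp

/-- Almost surely, the walk started from any point visits a set with null boundary with the
statistics of the walk started from the uniform distribution. -/
theorem tendsto_average_prod_indicator (hφ : ∀ k, k ≠ 0 → charCoeff ρ k ≠ 1) (s : J → ℕ)
    {U : Set (UnitAddTorus ι)} (hU : MeasurableSet U) (hU' : haarTorus ι (frontier U) = 0) :
    ∀ᵐ ω ∂P, ∀ x : UnitAddTorus ι,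
      Tendsto (fun N : ℕ => (N : ℝ)⁻¹ * ∑ i ∈ Finset.range N,
        ∏ j, U.indicator (fun _ => (1 : ℝ)) (x + walk ξ (i + s j) ω)) atTop
        (𝓝 (∫ x, ∫ ω, ∏ j, U.indicator (fun _ => (1 : ℝ)) (x + walk ξ (s j) ω) ∂P
          ∂haarTorus ι)) := by
  have := h.isProbabilityMeasure_tupleLaw s
  have hm : ∀ j, Measurable fun z : UnitAddTorus (J × ι) => (fun a => z (j, a) : UnitAddTorus ι) :=
    fun j => measurable_pi_lambda _ fun a => measurable_pi_apply _
  set E : Set (UnitAddTorus (J × ι)) := ⋂ j, {z | (fun a => z (j, a)) ∈ U} with hE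
  have hEm : MeasurableSet E := MeasurableSet.iInter fun j => hm j hU
  have hfr : tupleLaw ξ P s (frontier E) = 0 := by
    refine measure_mono_null (frontier_iInter_subset_iUnion_frontier _)
      (measure_iUnion_null fun j => ?_)
    have hc : Continuous fun z : UnitAddTorus (J × ι) => (fun a => z (j, a) : UnitAddTorus ι) :=
      by fun_prop
    refine measure_mono_null (hc.frontier_preimage_subset U) ?_
    exact (h.tupleLaw_preimage_eval s j isClosed_frontier.measurableSet).trans hU'
  have hind : ∀ i x ω, E.indicator (fun _ => (1 : ℝ)) (tuple ξ s i x ω) =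
      ∏ j, U.indicator (fun _ => (1 : ℝ)) (x + walk ξ (i + s j) ω) := by
    intro i x ω
    have hmem : tuple ξ s i x ω ∈ E ↔ ∀ j, x + walk ξ (i + s j) ω ∈ U := by
      rw [hE, Set.mem_iInter]; rfl
    by_cases hx : tuple ξ s i x ω ∈ E
    · rw [Set.indicator_of_mem hx]
      exact (Finset.prod_eq_one fun j _ => Set.indicator_of_mem (hmem.1 hx j) _).symm
    · rw [Set.indicator_of_notMem hx]
      rw [hmem, not_forall] at hx
      obtain ⟨j, hj⟩ := hx
      exact (Finset.prod_eq_zero (Finset.mem_univ j) (Set.indicator_of_notMem hj _)).symm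
  have hval : (tupleLaw ξ P s).real E = ∫ x, ∫ ω, ∏ j, U.indicator (fun _ => (1 : ℝ))
      (x + walk ξ (s j) ω) ∂P ∂haarTorus ι := by
    rw [← integral_indicator_one hEm, tupleLaw,
      integral_map (h.measurable_tuple s 0).aemeasurable
        (measurable_one.indicator hEm).aestronglyMeasurable]
    have e : ∀ y : UnitAddTorus ι × Ω, E.indicator (1 : UnitAddTorus (J × ι) → ℝ) (tuple ξ s 0 y.1 y.2) =
        ∏ j, U.indicator (fun _ => (1 : ℝ)) (y.1 + walk ξ (s j) y.2) := fun y => by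
      have := hind 0 y.1 y.2
      simp only [zero_add] at this
      exact this
    have hi : Integrable (fun y : UnitAddTorus ι × Ω => E.indicator (1 : UnitAddTorus (J × ι) → ℝ)
        (tuple ξ s 0 y.1 y.2)) ((haarTorus ι).prod P) := by
      refine Integrable.of_bound ((measurable_one.indicator hEm).comp
        (h.measurable_tuple s 0)).aestronglyMeasurable 1 (.of_forall fun y => ?_)
      by_cases hy : tuple ξ s 0 y.1 y.2 ∈ E <;> simp [hy]
    rw [integral_prod _ hi]
    exact integral_congr_ae (.of_forall fun x => integral_congr_ae (.of_forall fun ω => e (x, ω)))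
  filter_upwards [h.tendsto_average_mFourier_tuple hφ s] with ω hω x
  have h1 := tendsto_average_indicator_of_tendsto_average_mFourier (hω x) hfr
  simp_rw [hind, hval] at h1
  exact h1

end IsIIDSteps

end Tuple

/-! ### Correlations determine a function up to translation -/

section Correlation

variable {Ω : Type*} [MeasurableSpace Ω] {ι : Type*} [Fintype ι]

/-- The observation times `0, n₁, n₁ + n₂, …` with successive lags `n₁, n₂, …`. -/
def lagTimes : (ns : List ℕ) → Fin (ns.length + 1) → ℕ
  | [] => fun _ => 0
  | n :: ns => Fin.cons 0 fun j => n + lagTimes ns j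

/-- The expectation of the product of `f` along the positions, at the times `lagTimes ns`, of the
walk started at `x`. -/
def correlation (ξ : ℕ → Ω → UnitAddTorus ι) (P : Measure Ω) (f : UnitAddTorus ι → ℂ)
    (ns : List ℕ) (x : UnitAddTorus ι) : ℂ :=
  ∫ ω, ∏ j, f (x + walk ξ (lagTimes ns j) ω) ∂P

variable {ξ : ℕ → Ω → UnitAddTorus ι} {P : Measure Ω} {ρ : Measure (UnitAddTorus ι)}
  {f g : UnitAddTorus ι → ℂ}

theorem norm_prod_le_one {J E : Type*} [Fintype J] {f : E → ℂ} (hf : ∀ x, ‖f x‖ ≤ 1) (z : J → E) :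
    ‖∏ j, f (z j)‖ ≤ 1 := by
  rw [norm_prod]
  exact Finset.prod_le_one (fun _ _ => norm_nonneg _) fun _ _ => hf _

theorem memLp_of_norm_le_one (hf : Measurable f) (hf1 : ∀ x, ‖f x‖ ≤ 1) (p : ENNReal) :
    MemLp f p (haarTorus ι) :=
  MemLp.of_bound hf.aestronglyMeasurable 1 (.of_forall hf1)

theorem coeff_comp_add_right (f : UnitAddTorus ι → ℂ) (θ : UnitAddTorus ι) (k : ι → ℤ) :
    coeff (fun x => f (x + θ)) k = coeff f k * mFourier k θ := by
  have e : ∀ x, mFourier (-k) x * f (x + θ) =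
      (fun y => mFourier (-k) y * f y) (x + θ) * mFourier k θ := fun x => by
    have h1 : mFourier (-k) θ * mFourier k θ = 1 := by
      rw [← mFourier_add, neg_add_cancel, mFourier_zero, ContinuousMap.one_apply]
    simp only [mFourier_apply_add]
    linear_combination (-(mFourier (-k) x) * f (x + θ)) * h1
  unfold coeff
  simp_rw [e]
  rw [integral_mul_const]
  exact congrArg (· * _) (integral_add_right_eq_self (fun y => mFourier (-k) y * f y) θ)

namespace IsIIDSteps

variable (h : IsIIDSteps ξ P ρ) [IsProbabilityMeasure P]

include h

omit h in
theorem norm_correlation_le_one (hf1 : ∀ x, ‖f x‖ ≤ 1) (ns : List ℕ) (x : UnitAddTorus ι) :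
    ‖correlation ξ P f ns x‖ ≤ 1 := by
  have := norm_integral_le_of_norm_le_const (μ := P)
    (.of_forall fun ω => norm_prod_le_one hf1 fun j => x + walk ξ (lagTimes ns j) ω)
  simpa [correlation] using this

theorem measurable_correlation (hf : Measurable f) (ns : List ℕ) :
    Measurable (correlation ξ P f ns) := by
  have hm : Measurable fun y : UnitAddTorus ι × Ω =>
      ∏ j, f (y.1 + walk ξ (lagTimes ns j) y.2) :=
    Finset.measurable_prod _ fun j _ =>
      hf.comp (measurable_fst.add ((h.measurable_walk _).comp measurable_snd))
  exact hm.stronglyMeasurable.integral_prod_right.measurable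

theorem map_shift_steps (n : ℕ) :
    P.map (fun ω l => ξ (n + l) ω) = P.map (fun ω l => ξ l ω) := by
  have h1 : iIndepFun (fun l => ξ (n + l)) P := h.indep.precomp (add_right_injective n)
  rw [h1.map_fun_eq_infinitePi_map fun l => h.measurable _,
    h.indep.map_fun_eq_infinitePi_map h.measurable]
  simp_rw [h.map_eq]

omit h [IsProbabilityMeasure P] in
theorem correlation_nil [IsProbabilityMeasure P] (x : UnitAddTorus ι) :
    correlation ξ P f [] x = f x := by
  simp [correlation, lagTimes, walk]

/-- The Markov property at the first lag. -/
theorem correlation_cons (hf : Measurable f) (hf1 : ∀ x, ‖f x‖ ≤ 1) (n : ℕ) (ns : List ℕ)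
    (x : UnitAddTorus ι) :
    correlation ξ P f (n :: ns) x =
      f x * ∫ ω, correlation ξ P f ns (x + walk ξ n ω) ∂P := by
  set t := lagTimes ns
  set Φ : (ℕ → UnitAddTorus ι) → Fin (ns.length + 1) → UnitAddTorus ι :=
    fun y j => ∑ l ∈ Finset.range (t j), y l
  have hΦ : Measurable Φ := measurable_pi_lambda _ fun j =>
    Finset.measurable_sum _ fun l _ => measurable_pi_apply l
  -- `V` is the displacement after time `n`: it is independent of `walk ξ n` and has the law of
  -- `V₀`, by stationarity of the steps.
  set V : Ω → Fin (ns.length + 1) → UnitAddTorus ι := fun ω => Φ fun l => ξ (n + l) ω with hV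
  set V₀ : Ω → Fin (ns.length + 1) → UnitAddTorus ι := fun ω j => walk ξ (t j) ω with hV₀
  have hVm : Measurable V := hΦ.comp (measurable_pi_lambda _ fun l => h.measurable _)
  have hV₀m : Measurable V₀ := measurable_pi_lambda _ fun j => h.measurable_walk _
  have hmap : P.map V = P.map V₀ := by
    have h1 := congrArg (Measure.map Φ) (h.map_shift_steps n)
    rw [Measure.map_map hΦ (measurable_pi_lambda _ fun l => h.measurable _),
      Measure.map_map hΦ (measurable_pi_lambda _ fun l => h.measurable _)] at h1
    exact h1
  have hind : IndepFun (walk ξ n) V P := by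
    refine h.indepFun_of_disjoint (S := Set.Iio n) (T := Set.Ici n)
      (Set.disjoint_left.2 fun l hl hl' => (Set.mem_Iio.1 hl).not_ge hl')
      (measurable_walk_stepAlgebra fun l hl => hl) ?_
    refine @measurable_pi_lambda _ _ _ (stepAlgebra ξ (Set.Ici n)) _ _ fun j => ?_
    exact Finset.measurable_sum _ fun l _ => measurable_stepAlgebra (Set.mem_Ici.2 (by omega))
  have hprod := (indepFun_iff_map_prod_eq_prod_map_map (h.measurable_walk n).aemeasurable
    hVm.aemeasurable).1 hind
  rw [hmap] at hprod
  set q : UnitAddTorus ι × (Fin (ns.length + 1) → UnitAddTorus ι) → ℂ :=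
    fun y => ∏ j, f (x + y.1 + y.2 j) with hq
  have hqm : Measurable q := Finset.measurable_prod _ fun j _ =>
    hf.comp ((measurable_fst.const_add x).add ((measurable_pi_apply j).comp measurable_snd))
  have hq1 : ∀ y, ‖q y‖ ≤ 1 := fun y => norm_prod_le_one hf1 fun j => x + y.1 + y.2 j
  have hP1 : IsProbabilityMeasure (P.map (walk ξ n)) :=
    Measure.isProbabilityMeasure_map (h.measurable_walk n).aemeasurable
  have hP2 : IsProbabilityMeasure (P.map V₀) :=
    Measure.isProbabilityMeasure_map hV₀m.aemeasurable
  have key : ∫ ω, q (walk ξ n ω, V ω) ∂P = ∫ ω, ∫ ω', q (walk ξ n ω, V₀ ω') ∂P ∂P := by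
    rw [← integral_map (φ := fun ω => (walk ξ n ω, V ω))
      ((h.measurable_walk n).prodMk hVm).aemeasurable hqm.aestronglyMeasurable, hprod,
      integral_prod _ (Integrable.of_bound hqm.aestronglyMeasurable 1 (.of_forall hq1)),
      integral_map (h.measurable_walk n).aemeasurable
        hqm.stronglyMeasurable.integral_prod_right.aestronglyMeasurable]
    refine integral_congr_ae (.of_forall fun ω => ?_)
    exact integral_map hV₀m.aemeasurable (hqm.comp measurable_prodMk_left).aestronglyMeasurable
  have e : ∀ ω, ∏ j, f (x + walk ξ (lagTimes (n :: ns) j) ω) = f x * q (walk ξ n ω, V ω) := by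
    intro ω
    have : ∏ j, f (x + walk ξ (lagTimes (n :: ns) j) ω) =
        f (x + walk ξ (lagTimes (n :: ns) 0) ω) *
          ∏ j : Fin (ns.length + 1), f (x + walk ξ (lagTimes (n :: ns) j.succ) ω) :=
      Fin.prod_univ_succ _
    rw [this]
    simp only [lagTimes, Fin.cons_zero, Fin.cons_succ, hq, hV, walk_add, ← add_assoc]
    simp [walk, Φ, t]
  simp_rw [correlation, e]
  rw [integral_const_mul, key]

theorem integral_mFourier_walk (k : ι → ℤ) (n : ℕ) :
    ∫ ω, mFourier k (walk ξ n ω) ∂P = charCoeff ρ k ^ n := by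
  have := h.integral_prod_mFourier_step (fun _ => k) n
  simpa [walk, mFourier_apply_finset_sum] using this

/-- The transition operator commutes with translations, so characters diagonalise it, with
eigenvalues `charCoeff ρ k`. -/
theorem coeff_integral_walk (hf : Measurable f) (hf1 : ∀ x, ‖f x‖ ≤ 1) (n : ℕ) (k : ι → ℤ) :
    coeff (fun x => ∫ ω, f (x + walk ξ n ω) ∂P) k = coeff f k * charCoeff ρ k ^ n := by
  have hm : Measurable fun y : UnitAddTorus ι × Ω => mFourier (-k) y.1 * f (y.1 + walk ξ n y.2) :=
    ((measurable_mFourier _).comp measurable_fst).mul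
      (hf.comp (measurable_fst.add ((h.measurable_walk n).comp measurable_snd)))
  have hi : Integrable (fun y : UnitAddTorus ι × Ω => mFourier (-k) y.1 * f (y.1 + walk ξ n y.2))
      ((haarTorus ι).prod P) :=
    Integrable.of_bound hm.aestronglyMeasurable 1 (.of_forall fun y => by
      rw [norm_mul, norm_mFourier_apply, one_mul]; exact hf1 _)
  calc coeff (fun x => ∫ ω, f (x + walk ξ n ω) ∂P) k
      = ∫ x, ∫ ω, mFourier (-k) x * f (x + walk ξ n ω) ∂P ∂haarTorus ι := by
        simp_rw [integral_const_mul]; rfl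
    _ = ∫ ω, ∫ x, mFourier (-k) x * f (x + walk ξ n ω) ∂haarTorus ι ∂P :=
        integral_integral_swap hi
    _ = ∫ ω, coeff f k * mFourier k (walk ξ n ω) ∂P :=
        integral_congr_ae (.of_forall fun ω => coeff_comp_add_right f (walk ξ n ω) k)
    _ = coeff f k * charCoeff ρ k ^ n := by
        rw [integral_const_mul, h.integral_mFourier_walk]

/-- Parseval applied to the Markov property. The first lag `n` appears only as the exponent, so this
is an exponential sum in `n`. -/
theorem hasSum_coeff_correlation_cons (hf : Measurable f) (hf1 : ∀ x, ‖f x‖ ≤ 1) (n : ℕ)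
    (ns : List ℕ) (k : ι → ℤ) :
    HasSum (fun q => coeff f (k - q) * coeff (correlation ξ P f ns) q * charCoeff ρ q ^ n)
      (coeff (correlation ξ P f (n :: ns)) k) := by
  have hc := h.measurable_correlation hf ns
  have hc1 := norm_correlation_le_one (ξ := ξ) (P := P) hf1 ns
  set u : UnitAddTorus ι → ℂ := fun x => mFourier (-k) x * f x with hu
  set v : UnitAddTorus ι → ℂ := fun x => ∫ ω, correlation ξ P f ns (x + walk ξ n ω) ∂P with hv
  have hu2 : MemLp u 2 (haarTorus ι) := memLp_of_norm_le_one ((measurable_mFourier _).mul hf)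
    (fun x => by
      rw [Pi.mul_apply, norm_mul, norm_mFourier_apply, one_mul]; exact hf1 x) 2
  have hv2 : MemLp v 2 (haarTorus ι) := by
    refine memLp_of_norm_le_one ?_ (fun x => ?_) 2
    · have : Measurable fun y : UnitAddTorus ι × Ω =>
          correlation ξ P f ns (y.1 + walk ξ n y.2) :=
        hc.comp (measurable_fst.add ((h.measurable_walk n).comp measurable_snd))
      exact this.stronglyMeasurable.integral_prod_right.measurable
    · have := norm_integral_le_of_norm_le_const (μ := P)
        (.of_forall fun ω => hc1 (x + walk ξ n ω))
      simpa using this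
  have h1 := hasSum_coeff_neg_mul hu2 hv2
  have e1 : ∫ x, u x * v x ∂haarTorus ι = coeff (correlation ξ P f (n :: ns)) k := by
    refine integral_congr_ae (.of_forall fun x => ?_)
    simp only [hu, hv, h.correlation_cons hf hf1, mul_assoc]
  rw [e1] at h1
  refine h1.congr_fun fun q => ?_
  have e2 : coeff u (-q) = coeff f (k - q) := by
    refine integral_congr_ae (.of_forall fun x => ?_)
    simp only [hu]
    rw [← mul_assoc, ← mFourier_add]
    congr 3
    abel
  rw [e2, hv, h.coeff_integral_walk hc hc1, mul_assoc]

variable {β : ℂ}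

/-- Uniqueness for exponential sums, applied in the first lag, isolates the term `q = k - p` and
peels off one factor `coeff f p`. -/
theorem mul_coeff_correlation_eq_of_forall (hφ : Tendsto (charCoeff ρ) cofinite (𝓝 β))
    (hinj : Function.Injective (charCoeff ρ)) (hne : ∀ k, charCoeff ρ k ≠ β)
    (hf : Measurable f) (hf1 : ∀ x, ‖f x‖ ≤ 1) (hg : Measurable g) (hg1 : ∀ x, ‖g x‖ ≤ 1)
    {k : ι → ℤ} {a b : ℂ}
    (hk : ∀ ns, a * coeff (correlation ξ P f ns) k = b * coeff (correlation ξ P g ns) k)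
    (p : ι → ℤ) (ns : List ℕ) :
    a * coeff f p * coeff (correlation ξ P f ns) (k - p) =
      b * coeff g p * coeff (correlation ξ P g ns) (k - p) := by
  have := h.isProbabilityMeasure
  have key := eq_of_tsum_mul_pow_eq
    (b := fun q => a * coeff f (k - q) * coeff (correlation ξ P f ns) q)
    (c := fun q => b * coeff g (k - q) * coeff (correlation ξ P g ns) q)
    -- The lag `0` gives the summability of the coefficients themselves.
    (by simpa [mul_assoc] using (h.hasSum_coeff_correlation_cons hf hf1 0 ns k).summable.mul_left a)
    (by simpa [mul_assoc] using (h.hasSum_coeff_correlation_cons hg hg1 0 ns k).summable.mul_left b)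
    hφ hinj hne (norm_charCoeff_le ρ) (fun n => by
      have h1 := ((h.hasSum_coeff_correlation_cons hf hf1 n ns k).mul_left a).tsum_eq
      have h2 := ((h.hasSum_coeff_correlation_cons hg hg1 n ns k).mul_left b).tsum_eq
      simp only [mul_assoc] at h1 h2 ⊢
      rw [h1, h2, hk]) (k - p)
  simpa using key

/-- Peeling is iterated from frequency `0`, where the coefficient is the mean of the correlation.
The last factor comes from the empty list of lags, for which the correlation is the function itself.
-/
theorem prod_coeff_eq (hφ : Tendsto (charCoeff ρ) cofinite (𝓝 β))
    (hinj : Function.Injective (charCoeff ρ)) (hne : ∀ k, charCoeff ρ k ≠ β)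
    (hf : Measurable f) (hf1 : ∀ x, ‖f x‖ ≤ 1) (hg : Measurable g) (hg1 : ∀ x, ‖g x‖ ≤ 1)
    (hfg : ∀ ns, ∫ x, correlation ξ P f ns x ∂haarTorus ι =
      ∫ x, correlation ξ P g ns x ∂haarTorus ι) (l : List (ι → ℤ)) (hl : l.sum = 0) :
    (l.map (coeff f)).prod = (l.map (coeff g)).prod := by
  have key : ∀ (l : List (ι → ℤ)) (ns : List ℕ),
      (l.map (coeff f)).prod * coeff (correlation ξ P f ns) (-l.sum) =
        (l.map (coeff g)).prod * coeff (correlation ξ P g ns) (-l.sum) := by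
    intro l
    induction l with
    | nil => intro ns; simpa [coeff, mFourier_zero] using hfg ns
    | cons p l ih =>
      intro ns
      have := h.mul_coeff_correlation_eq_of_forall hφ hinj hne hf hf1 hg hg1 ih p ns
      simp only [List.map_cons, List.prod_cons, List.sum_cons, neg_add_rev, ← sub_eq_add_neg]
      linear_combination this
  cases l with
  | nil => simp
  | cons p l =>
    have h1 : p = -l.sum := by rw [List.sum_cons] at hl; exact eq_neg_of_add_eq_zero_left hl
    have h2 := key l []
    have e : ∀ f : UnitAddTorus ι → ℂ, correlation ξ P f [] = f := fun f =>
      funext correlation_nil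
    rw [e, e, ← h1] at h2
    simp only [List.map_cons, List.prod_cons]
    linear_combination h2

/-- Two bounded real functions with the same correlations are translates of each other. -/
theorem exists_translate_of_correlation_eq (hφ : Tendsto (charCoeff ρ) cofinite (𝓝 β))
    (hinj : Function.Injective (charCoeff ρ)) (hne : ∀ k, charCoeff ρ k ≠ β)
    (hf : Measurable f) (hf1 : ∀ x, ‖f x‖ ≤ 1) (hfr : ∀ x, conj (f x) = f x)
    (hg : Measurable g) (hg1 : ∀ x, ‖g x‖ ≤ 1) (hgr : ∀ x, conj (g x) = g x)
    (hfg : ∀ ns, ∫ x, correlation ξ P f ns x ∂haarTorus ι =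
      ∫ x, correlation ξ P g ns x ∂haarTorus ι) :
    ∃ θ : UnitAddTorus ι, ∀ᵐ x ∂haarTorus ι, g x = f (x + θ) := by
  have hneg : ∀ {f : UnitAddTorus ι → ℂ}, (∀ x, conj (f x) = f x) →
      ∀ p, coeff f (-p) = conj (coeff f p) := fun {f} hfr p => by
    have := coeff_conj f p
    simp only [hfr] at this
    exact this.symm
  obtain ⟨θ, hθ⟩ := exists_eq_mul_mFourier (hneg hfr) (hneg hgr)
    (h.prod_coeff_eq hφ hinj hne hf hf1 hg hg1 hfg)
  refine ⟨θ, ae_eq_of_coeff_eq (memLp_of_norm_le_one hg hg1 2)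
    (memLp_of_norm_le_one (hf.comp (measurable_add_const θ)) (fun x => hf1 _) 2) fun k => ?_⟩
  rw [hθ k]
  exact (coeff_comp_add_right f θ k).symm

end IsIIDSteps

end Correlation

/-! ### Reconstruction of sets from the trace of the walk -/

section Reconstruction

variable {Ω : Type*} [MeasurableSpace Ω] {ι : Type*} [Fintype ι]
  {ξ : ℕ → Ω → UnitAddTorus ι} {P : Measure Ω} {ρ : Measure (UnitAddTorus ι)}

/-- The mean, from a uniform starting point, of the product of the indicator of `U` along the
times `lagTimes ns`. -/
def setStatistic (ξ : ℕ → Ω → UnitAddTorus ι) (P : Measure Ω) (U : Set (UnitAddTorus ι))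
    (ns : List ℕ) : ℝ :=
  ∫ x, ∫ ω, ∏ j, U.indicator (fun _ => (1 : ℝ)) (x + walk ξ (lagTimes ns j) ω) ∂P ∂haarTorus ι

theorem ofReal_setStatistic (U : Set (UnitAddTorus ι)) (ns : List ℕ) :
    (setStatistic ξ P U ns : ℂ) =
      ∫ x, correlation ξ P (fun y => ((U.indicator (fun _ => (1 : ℝ)) y : ℝ) : ℂ)) ns x ∂haarTorus ι := by
  simp only [setStatistic, correlation, ← Complex.ofReal_prod, integral_complex_ofReal]

theorem charCoeff_zero [IsProbabilityMeasure ρ] : charCoeff ρ 0 = 1 := by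
  simp [charCoeff, mFourier_zero]

namespace IsIIDSteps

variable (h : IsIIDSteps ξ P ρ) [IsProbabilityMeasure P] {β : ℂ}

include h

theorem exists_translate_of_setStatistic_eq (hφ : Tendsto (charCoeff ρ) cofinite (𝓝 β))
    (hinj : Function.Injective (charCoeff ρ)) (hne : ∀ k, charCoeff ρ k ≠ β)
    {U V : Set (UnitAddTorus ι)} (hU : MeasurableSet U) (hV : MeasurableSet V)
    (hUV : ∀ ns, setStatistic ξ P U ns = setStatistic ξ P V ns) :
    ∃ θ : UnitAddTorus ι, ∀ᵐ x ∂haarTorus ι,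
      V.indicator (fun _ => (1 : ℝ)) x = U.indicator (fun _ => (1 : ℝ)) (x + θ) := by
  have hm : ∀ {W : Set (UnitAddTorus ι)}, MeasurableSet W →
      Measurable fun y => ((W.indicator (fun _ => (1 : ℝ)) y : ℝ) : ℂ) := fun hW =>
    Complex.measurable_ofReal.comp (measurable_const.indicator hW)
  have h1 : ∀ (W : Set (UnitAddTorus ι)) y, ‖((W.indicator (fun _ => (1 : ℝ)) y : ℝ) : ℂ)‖ ≤ 1 :=
    fun W y => by by_cases hy : y ∈ W <;> simp [hy]
  obtain ⟨θ, hθ⟩ := h.exists_translate_of_correlation_eq hφ hinj hne (hm hU) (h1 U)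
    (fun _ => Complex.conj_ofReal _) (hm hV) (h1 V) (fun _ => Complex.conj_ofReal _)
    fun ns => by rw [← ofReal_setStatistic, ← ofReal_setStatistic, hUV]
  exact ⟨θ, hθ.mono fun x hx => Complex.ofReal_injective hx⟩

/-- A single map recovers, up to translation, every open set with null boundary from the trace of
the walk, whatever the starting point. -/
theorem exists_reconstruction (hφ : Tendsto (charCoeff ρ) cofinite (𝓝 β))
    (hinj : Function.Injective (charCoeff ρ)) (hne : ∀ k, charCoeff ρ k ≠ β) :
    ∃ A : (ℕ → ℝ) → UnitAddTorus ι → ℝ, ∀ U : Set (UnitAddTorus ι), IsOpen U →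
      haarTorus ι (frontier U) = 0 → ∀ᵐ ω ∂P, ∀ x, ∃ θ, ∀ᵐ y ∂haarTorus ι,
        A (fun n => U.indicator (fun _ => (1 : ℝ)) (x + walk ξ n ω)) y =
          U.indicator (fun _ => (1 : ℝ)) (y + θ) := by
  classical
  have := h.isProbabilityMeasure
  -- Compatibility involves only the trace and the known law of the walk, so a set can be chosen
  -- without knowing `U`.
  set fits : (ℕ → ℝ) → Set (UnitAddTorus ι) → Prop := fun w V => MeasurableSet V ∧
    ∀ ns, Tendsto (fun N : ℕ => (N : ℝ)⁻¹ * ∑ i ∈ Finset.range N, ∏ j, w (i + lagTimes ns j)) atTop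
      (𝓝 (setStatistic ξ P V ns)) with hfits
  refine ⟨fun w => if hw : ∃ V, fits w V then hw.choose.indicator (fun _ => 1) else 0,
    fun U hU hU' => ?_⟩
  -- Injectivity gives ergodicity of the walk, since the coefficient at `0` is already `1`.
  have h1 : ∀ k, k ≠ 0 → charCoeff ρ k ≠ 1 := fun k hk hk' =>
    hk (hinj (hk'.trans charCoeff_zero.symm))
  filter_upwards [ae_all_iff.2 fun ns : List ℕ =>
    h.tendsto_average_prod_indicator h1 (lagTimes ns) hU.measurableSet hU'] with ω hω x
  set w : ℕ → ℝ := fun n => U.indicator (fun _ => (1 : ℝ)) (x + walk ξ n ω)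
  have hwU : fits w U := ⟨hU.measurableSet, fun ns => hω ns x⟩
  have hw : ∃ V, fits w V := ⟨U, hwU⟩
  simp only [dif_pos hw]
  exact h.exists_translate_of_setStatistic_eq hφ hinj hne hU.measurableSet hw.choose_spec.1
    fun ns => tendsto_nhds_unique (hwU.2 ns) (hw.choose_spec.2 ns)

end IsIIDSteps

end Reconstruction

/-! ### Rescaling the torus of period `2π` -/

section Rescaling

variable {d : ℕ}

/-- The rescaling `(ℝ/2πℤ)^d → (ℝ/ℤ)^d`. -/
def rescale (d : ℕ) : Torus d ≃ₜ UnitAddTorus (Fin d) :=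
  Homeomorph.piCongrRight fun _ =>
    AddCircle.homeomorphAddCircle (2 * Real.pi) 1 Real.two_pi_pos.ne' one_ne_zero

theorem rescale_apply (x : Torus d) (j : Fin d) : rescale d x j =
    AddCircle.equivAddCircle (2 * Real.pi) 1 Real.two_pi_pos.ne' one_ne_zero (x j) := rfl

theorem rescale_add (x y : Torus d) : rescale d (x + y) = rescale d x + rescale d y := by
  ext j
  simp only [rescale_apply, Pi.add_apply, map_add]

/-- `rescale` as an isomorphism of groups. -/
def rescaleAddEquiv (d : ℕ) : Torus d ≃+ UnitAddTorus (Fin d) where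
  __ := (rescale d).toEquiv
  map_add' := rescale_add

theorem rescale_sub (x y : Torus d) : rescale d (x - y) = rescale d x - rescale d y :=
  map_sub (rescaleAddEquiv d) x y

theorem rescale_zero : rescale d 0 = 0 := map_zero (rescaleAddEquiv d)

theorem mFourier_rescale (k : Fin d → ℤ) (x : Torus d) :
    mFourier k (rescale d x) = ∏ j, fourier (k j) (x j) := by
  simp only [mFourier, ContinuousMap.coe_mk, rescale_apply]
  refine Finset.prod_congr rfl fun j _ => ?_
  induction x j using QuotientAddGroup.induction_on with
  | H y =>
    rw [AddCircle.equivAddCircle_apply_mk, fourier_coe_apply, fourier_coe_apply]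
    congr 1
    push_cast
    field_simp

/-- Uniqueness of Haar measure up to a scalar; only `c ≠ 0` is needed, for null sets and for decay
of coefficients. -/
theorem exists_map_rescale_volume (d : ℕ) : ∃ c : ℝ≥0, c ≠ 0 ∧
    (volume : Measure (Torus d)).map (rescale d) = c • haarTorus (Fin d) := by
  have h1 : ((volume : Measure (Torus d)).map (rescale d)).IsAddHaarMeasure :=
    (rescaleAddEquiv d).isAddHaarMeasure_map volume (rescale d).continuous
      (rescale d).symm.continuous
  have h2 := Measure.isAddLeftInvariant_eq_smul ((volume : Measure (Torus d)).map (rescale d))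
    (haarTorus (Fin d))
  refine ⟨_, fun h0 => ?_, h2⟩
  rw [h0, zero_smul] at h2
  exact (NeZero.ne ((volume : Measure (Torus d)).map (rescale d))) h2

theorem torusFourierCoeff_eq_integral (g : Torus d → ℂ) (k : Fin d → ℤ) :
    torusFourierCoeff g k = ∫ x, g x * mFourier (-k) (rescale d x) := by
  simp only [torusFourierCoeff, mFourier_rescale, Pi.neg_apply]

theorem tendsto_torusFourierCoeff {g : Torus d → ℂ} (hg : MemLp g 2 volume) :
    Tendsto (torusFourierCoeff g) cofinite (𝓝 0) := by
  obtain ⟨c, hc, hmap⟩ := exists_map_rescale_volume d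
  set g' : UnitAddTorus (Fin d) → ℂ := g ∘ (rescale d).symm
  have hme : MeasurableEmbedding (rescale d) := (rescale d).measurableEmbedding
  have hcomp : g' ∘ rescale d = g := by ext x; simp [g']
  have h1 : MemLp g' 2 ((volume : Measure (Torus d)).map (rescale d)) := by
    rw [hme.memLp_map_measure_iff, hcomp]
    exact hg
  rw [hmap] at h1
  have h2 : MemLp g' 2 (haarTorus (Fin d)) := by
    have := h1.smul_measure (c := (c⁻¹ : ℝ≥0)) ENNReal.coe_ne_top
    have e : ((c⁻¹ : ℝ≥0) : ENNReal) • (c • haarTorus (Fin d)) = haarTorus (Fin d) := by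
      rw [ENNReal.smul_def, smul_smul, ← ENNReal.coe_mul, inv_mul_cancel₀ hc, ENNReal.coe_one,
        one_smul]
    rwa [e] at this
  have h3 : ∀ k, torusFourierCoeff g k = (c : ℂ) * coeff g' k := fun k => by
    have e : ∀ x, g x * mFourier (-k) (rescale d x) =
        (fun y => mFourier (-k) y * g' y) (rescale d x) := fun x => by
      simp [g', mul_comm]
    rw [torusFourierCoeff_eq_integral]
    simp_rw [e]
    rw [← hme.integral_map (fun y => mFourier (-k) y * g' y), hmap, integral_smul_nnreal_measure]
    rfl
  have h4 := (tendsto_coeff_cofinite h2).const_mul (c : ℂ)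
  rw [mul_zero] at h4
  exact h4.congr fun k => (h3 k).symm

end Rescaling

/-! ### Increment laws that are mixtures of an atom and a density -/

section Increments

variable {Ω : Type*} [MeasurableSpace Ω] {P : Measure Ω} [IsProbabilityMeasure P] {d : ℕ}
  {X : ℝ≥0 → Ω → Torus d} {D : ℝ≥0 → Measure (Torus d)} {β : ℝ≥0 → ℝ} {γ : ℝ≥0 → Torus d → ℝ}

theorem isProbabilityMeasure_increment (hX : IsInfDivProcess X P D) (t : ℝ≥0) :
    IsProbabilityMeasure (D t) := by
  have := hX.map_sub 0 t zero_le
  rw [tsub_zero] at this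
  rw [← this]
  exact Measure.isProbabilityMeasure_map ((hX.measurable t).sub (hX.measurable 0)).aemeasurable

theorem charCoeff_map_rescale (μ : Measure (Torus d)) (k : Fin d → ℤ) :
    charCoeff (μ.map (rescale d)) k = ∫ x, mFourier k (rescale d x) ∂μ :=
  (rescale d).measurableEmbedding.integral_map _

theorem measurable_mFourier_rescale (k : Fin d → ℤ) :
    Measurable fun x : Torus d => mFourier k (rescale d x) :=
  (measurable_mFourier k).comp (rescale d).measurable

/-- The frequency `-k` reflects the opposite sign conventions of `charCoeff` and
`torusFourierCoeff`. -/
theorem charCoeff_increment (hD : IsAtomDensityMixture D β γ) {t : ℝ≥0} (ht : 0 < t)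
    (k : Fin d → ℤ) : charCoeff ((D t).map (rescale d)) k =
      β t + (1 - β t) * torusFourierCoeff (fun x => (γ t x : ℂ)) (-k) := by
  obtain ⟨h0, h1⟩ := hD.mem_Icc t ht
  have hγ := hD.density t ht
  have hbd : ∀ μ : Measure (Torus d), IsFiniteMeasure μ →
      Integrable (fun x => mFourier k (rescale d x)) μ := fun μ _ =>
    Integrable.of_bound (measurable_mFourier_rescale k).aestronglyMeasurable 1
      (.of_forall fun x => (norm_mFourier_apply _ _).le)
  have hint : Integrable (γ t) := hγ.memLp.integrable (by norm_num)
  have hfin : IsFiniteMeasure (volume.withDensity fun x => ENNReal.ofReal (γ t x)) :=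
    isFiniteMeasure_withDensity_ofReal hint.2
  have hdens : ∫ x, mFourier k (rescale d x) ∂volume.withDensity (fun x => ENNReal.ofReal (γ t x))
      = torusFourierCoeff (fun x => (γ t x : ℂ)) (-k) := by
    rw [integral_withDensity_eq_integral_toReal_smul₀ hint.1.aemeasurable.ennreal_ofReal
      (.of_forall fun x => ENNReal.ofReal_lt_top), torusFourierCoeff_eq_integral, neg_neg]
    refine integral_congr_ae ?_
    filter_upwards [hγ.nonneg] with x hx
    rw [ENNReal.toReal_ofReal hx, Complex.real_smul]
  rw [charCoeff_map_rescale, hD.eq_mixture t ht, integral_add_measure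
    ((hbd _ inferInstance).smul_measure ENNReal.ofReal_ne_top)
    ((hbd _ hfin).smul_measure ENNReal.ofReal_ne_top), integral_smul_measure,
    integral_smul_measure, integral_dirac, hdens, rescale_zero, mFourier_apply_zero,
    ENNReal.toReal_ofReal h0, ENNReal.toReal_ofReal (sub_nonneg.2 h1)]
  simp

theorem tendsto_charCoeff_increment (hD : IsAtomDensityMixture D β γ) {t : ℝ≥0} (ht : 0 < t) :
    Tendsto (charCoeff ((D t).map (rescale d))) cofinite (𝓝 (β t : ℂ)) := by
  have h1 := tendsto_torusFourierCoeff (g := fun x => (γ t x : ℂ)) (hD.density t ht).memLp.ofReal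
  have h2 := ((h1.comp neg_injective.tendsto_cofinite).const_mul (1 - β t : ℂ)).const_add (β t : ℂ)
  rw [mul_zero, add_zero] at h2
  exact h2.congr fun k => (charCoeff_increment hD ht k).symm

theorem charCoeff_increment_add (hX : IsInfDivProcess X P D) (s t : ℝ≥0) (k : Fin d → ℤ) :
    charCoeff ((D (s + t)).map (rescale d)) k =
      charCoeff ((D s).map (rescale d)) k * charCoeff ((D t).map (rescale d)) k := by
  have := isProbabilityMeasure_increment hX s
  have := isProbabilityMeasure_increment hX t
  have hi : Integrable (fun x => mFourier k (rescale d x)) (Measure.conv (D s) (D t)) :=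
    Integrable.of_bound (measurable_mFourier_rescale k).aestronglyMeasurable 1
      (.of_forall fun x => (norm_mFourier_apply _ _).le)
  simp only [charCoeff_map_rescale]
  rw [hX.conv, integral_conv hi]
  simp only [rescale_add, mFourier_apply_add, integral_const_mul, integral_mul_const]

/-- On a torus of positive dimension the atom never has full mass. -/
theorem atom_ne_one [NeZero d] (hX : IsInfDivProcess X P D) (hD : IsAtomDensityMixture D β γ)
    (hβ : ∃ t, 0 < t ∧ β t ≠ 1) {t₀ : ℝ≥0} (ht₀ : 0 < t₀) : β t₀ ≠ 1 := by
  intro h1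
  obtain ⟨t, ht, hβt⟩ := hβ
  have hone : ∀ (n : ℕ) k, charCoeff ((D ((n + 1 : ℕ) • t₀)).map (rescale d)) k = 1 := by
    intro n k
    induction n with
    | zero => simp [charCoeff_increment hD ht₀, h1]
    | succ n ih =>
      rw [succ_nsmul, charCoeff_increment_add hX, ih, charCoeff_increment hD ht₀, h1]
      simp
  obtain ⟨n, hn⟩ := Archimedean.arch t ht₀
  have hle : ∀ s k, ‖charCoeff ((D s).map (rescale d)) k‖ ≤ 1 := fun s k => by
    have := isProbabilityMeasure_increment hX s
    have : IsProbabilityMeasure ((D s).map (rescale d)) :=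
      Measure.isProbabilityMeasure_map (rescale d).measurable.aemeasurable
    exact norm_charCoeff_le _ k
  have hnorm : ∀ k, ‖charCoeff ((D t).map (rescale d)) k‖ = 1 := by
    intro k
    -- The multiple `n + 1` matches `hone`, which concerns positive multiples only. The coefficient
    -- at time `t` is a factor of `1` in a product of two numbers of modulus at most `1`, so its
    -- modulus is `1`.
    have htn : t ≤ (n + 1) • t₀ := hn.trans (by gcongr; omega)
    have h2 := hone n k
    rw [← add_tsub_cancel_of_le htn, charCoeff_increment_add hX] at h2
    have h3 := congrArg norm h2
    rw [norm_mul, norm_one] at h3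
    refine le_antisymm (hle t k) ?_
    calc (1 : ℝ) = _ := h3.symm
      _ ≤ _ := mul_le_of_le_one_right (norm_nonneg _) (hle _ k)
  -- The coefficients at time `t` tend to `β t`, so `β t = 1`. Positive dimension makes `cofinite`
  -- nontrivial, hence the limit unique.
  have h4 := (tendsto_charCoeff_increment hD ht).norm
  simp only [hnorm] at h4
  have h5 := tendsto_nhds_unique h4 tendsto_const_nhds
  rw [Complex.norm_real, Real.norm_of_nonneg (hD.mem_Icc t ht).1] at h5
  exact hβt h5

theorem isIIDSteps_increments (hX : IsInfDivProcess X P D) (t₀ : ℝ≥0) :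
    IsIIDSteps (fun n ω => rescale d (X ((n + 1 : ℕ) • t₀) ω - X (n • t₀) ω)) P
      ((D t₀).map (rescale d)) where
  measurable n := (rescale d).measurable.comp ((hX.measurable _).sub (hX.measurable _))
  indep := (hX.indep.nat (t := fun n : ℕ => n • t₀) (nsmul_left_monotone zero_le)).comp
    (fun _ => rescale d) fun _ => (rescale d).measurable
  map_eq n := by
    have h1 := hX.map_sub (n • t₀) ((n + 1 : ℕ) • t₀)
      (nsmul_left_monotone zero_le (Nat.le_succ n))
    rw [succ_nsmul, add_tsub_cancel_left] at h1
    have hm : Measurable fun ω => X (n • t₀ + t₀) ω - X (n • t₀) ω :=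
      (hX.measurable _).sub (hX.measurable _)
    rw [← h1, Measure.map_map (rescale d).measurable hm, succ_nsmul]
    rfl

theorem rescale_eq_add_walk (X : ℝ≥0 → Ω → Torus d) (t₀ : ℝ≥0) (n : ℕ) (ω : Ω) :
    rescale d (X (n • t₀) ω) = rescale d (X 0 ω) +
      walk (fun n ω => rescale d (X ((n + 1 : ℕ) • t₀) ω - X (n • t₀) ω)) n ω := by
  simp only [walk, rescale_sub]
  rw [Finset.sum_range_sub (fun i : ℕ => rescale d (X (i • t₀) ω)), zero_smul, add_sub_cancel]

/-- The torus is a single point, so one observation gives the whole function. -/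
theorem reconstructible_of_dim_zero (X : ℝ≥0 → Ω → Torus 0) (F : Set (Torus 0 → ℝ)) :
    Reconstructible F X P :=
  ⟨fun w _ => w 0, fun f _ => .of_forall fun _ => ⟨0, .of_forall fun _ =>
    congrArg f (Subsingleton.elim _ _)⟩⟩

theorem reconstructible_openIndicators [NeZero d] (hX : IsInfDivProcess X P D)
    (hD : IsAtomDensityMixture D β γ) (hβ : ∃ t, 0 < t ∧ β t ≠ 1) {t₀ : ℝ≥0} (ht₀ : 0 < t₀)
    (hinj : Function.Injective fun k : Fin d → ℤ => torusFourierCoeff (fun x => (γ t₀ x : ℂ)) k)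
    (hne : ∀ k : Fin d → ℤ, torusFourierCoeff (fun x => (γ t₀ x : ℂ)) k ≠ 0) :
    Reconstructible (openIndicators d) X P := by
  have hβ₀ : (1 - β t₀ : ℂ) ≠ 0 :=
    sub_ne_zero.2 (by exact_mod_cast (atom_ne_one hX hD hβ ht₀).symm)
  obtain ⟨A, hA⟩ := (isIIDSteps_increments hX t₀).exists_reconstruction
    (tendsto_charCoeff_increment hD ht₀)
    (fun k l hkl => by
      rw [charCoeff_increment hD ht₀, charCoeff_increment hD ht₀] at hkl
      exact neg_injective (hinj (mul_left_cancel₀ hβ₀ (add_left_cancel hkl))))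
    (fun k hk => by
      rw [charCoeff_increment hD ht₀, add_eq_left] at hk
      exact mul_ne_zero hβ₀ (hne _) hk)
  obtain ⟨c, hc, hmap⟩ := exists_map_rescale_volume d
  refine ⟨fun w x => A (fun n => w (n • t₀)) (rescale d x), ?_⟩
  rintro _ ⟨U, hU, hU', rfl⟩
  set V : Set (UnitAddTorus (Fin d)) := (rescale d).symm ⁻¹' U with hV
  have hind : ∀ x, V.indicator (fun _ => (1 : ℝ)) (rescale d x) = U.indicator (fun _ => 1) x :=
    fun x => by
      have hmem : rescale d x ∈ V ↔ x ∈ U := by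
        rw [hV, Set.mem_preimage, Homeomorph.symm_apply_apply]
      by_cases hx : x ∈ U <;> simp [hx, hmem]
  have hV' : haarTorus (Fin d) (frontier V) = 0 := by
    have h1 : ((volume : Measure (Torus d)).map (rescale d)) (frontier V) = 0 := by
      rw [hV, ← Homeomorph.preimage_frontier,
        Measure.map_apply (rescale d).measurable
          ((rescale d).symm.measurable isClosed_frontier.measurableSet),
        ← Set.preimage_comp, Homeomorph.symm_comp_self, Set.preimage_id, hU']
    rw [hmap, Measure.smul_apply, smul_eq_zero] at h1
    exact h1.resolve_left hc
  filter_upwards [hA V (hU.preimage (rescale d).symm.continuous) hV'] with ω hω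
  -- The starting point is random and may depend on the increments; this is harmless because `hω`
  -- holds for all starting points at once.
  obtain ⟨θ, hθ⟩ := hω (rescale d (X 0 ω))
  refine ⟨(rescale d).symm θ, ?_⟩
  have h2 : ∀ᵐ y ∂(volume : Measure (Torus d)).map (rescale d),
      A (fun n => V.indicator (fun _ => (1 : ℝ)) (rescale d (X 0 ω) +
        walk (fun n ω => rescale d (X ((n + 1 : ℕ) • t₀) ω - X (n • t₀) ω)) n ω)) y =
          V.indicator (fun _ => (1 : ℝ)) (y + θ) := by
    rw [hmap]
    exact Measure.smul_absolutelyContinuous.ae_le hθ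
  filter_upwards [ae_of_ae_map (rescale d).measurable.aemeasurable h2] with x hx
  simp only [← rescale_eq_add_walk, hind] at hx
  rw [hx, ← hind, rescale_add, Homeomorph.apply_symm_apply]

end Increments

end SceneryReconstruction

end

theorem theorem1p2 {Ω : Type*} [MeasurableSpace Ω] (P : Measure Ω) [IsProbabilityMeasure P]
    (d : ℕ) (X : ℝ≥0 → Ω → Torus d) (D : ℝ≥0 → Measure (Torus d)) (β : ℝ≥0 → ℝ)
    (γ : ℝ≥0 → Torus d → ℝ)
    (hX : IsInfDivProcess X P D)
    (hD : IsAtomDensityMixture D β γ)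
    (hβ : ∃ t, 0 < t ∧ β t ≠ 1)
    (t₀ : ℝ≥0) (ht₀ : 0 < t₀)
    (hinj : Function.Injective fun k : Fin d → ℤ => torusFourierCoeff (fun x => (γ t₀ x : ℂ)) k)
    (hne : ∀ k : Fin d → ℤ, torusFourierCoeff (fun x => (γ t₀ x : ℂ)) k ≠ 0) :
    Reconstructible (openIndicators d) X P := by
  rcases eq_or_ne d 0 with rfl | hd
  · exact SceneryReconstruction.reconstructible_of_dim_zero X _
  · have : NeZero d := ⟨hd⟩
    exact SceneryReconstruction.reconstructible_openIndicators hX hD hβ ht₀ hinj hne
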